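/- Let $D=[0,T)$ with $0<T\le\infty$ or $D=[0,T]$ with $0<T<\infty$, and let $\psi:D\to[0,\infty)$ be a probability density that is positive almost everywhere. Put $\overline\psi(t)=\int_{D\cap(t,\infty)}\psi(y)\,dy$, $m_\psi=\int_D y\,\psi(y)\,dy$ and $\kappa_\psi=\|\overline\psi/\psi\|_{L_\infty(D)}$. For $p\in[1,\infty]$ with conjugate exponent $p'$ let $(\mathrm{I}_p)$ be the condition: $\overline\psi\in L_1(D)$ if $p=\infty$; and, if $p<\infty$, $\psi^{-1/p}\in L_{p'}([0,x))$ for all $x\in D$ and $\overline\psi\,\psi^{-1/p}\in L_{p'}(D)$. For $u\subseteq\{1,\dots,d\}$ let $L_{p,\psi}(D^u)$ be the $L_p$ space on $D^u$ with respect to $\prod_{j\in u}\psi(t_j)\,dt_u$ (it is $\mathbb R$ for $u=\emptyset$), and put $$T_{K,u}(g)(x)=\int_{D^u}g(t)\prod_{j\in u}K(x_j,t_j)\,dt\qquad(x\in D^d),$$ with $K(x,t)=1_{[0,x)}(t)$ in the anchored case and $K(x,t)=1_{[0,x)}(t)-\overline\psi(t)$ in the ANOVA case. For positive weights $\gamma=(\gamma_u)_u$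 the anchored (ANOVA) space consists of all functions $f=\sum_u T_{K,u}(g_u)$ on $D^d$ with $g_u\in L_{p,\psi}(D^u)$ (the $g_u$ are then unique), with norm the $\ell_q$ norm of the family $(\|g_u\|_{L_{p,\psi}(D^u)}/\gamma_u)_u$, where $q\in[1,\infty]$. Let $\imath_{p,q}$ be the embedding of the ANOVA space into the anchored space. The norms are uniformly equivalent if $\sup_d\|\imath_{p,q}\|<\infty$, and polynomially equivalent if $\|\imath_{p,q}\|=O(d^\tau)$ for some $\tau>0$. Further let, with $c=m_\psi$ if $p=\infty$ and $c=\kappa_\psi$ if $p=1$, $$C_{p,\infty}=\max_u\sum_{v\subseteq u^c}c^{|v|}\frac{\gamma_{u\cup v}}{\gamma_u},\qquad C_{p,1}=\max_v\sum_{u\subseteq v}c^{|v|-|u|}\frac{\gamma_v}{\gamma_u}.$$ Consider the product weights $\gamma_u=\prod_{j\in u}\gamma_j$ with positive reals $\gamma_1,\gamma_2,\dots$. Then: 1. If $(\mathrm{I}_\infty)$ holds, then for all $d\ge1$ and $q\in\{1,\infty\}$: $\|\imath_{\infty,q}\|=\|\imath_{\infty,q}^{-1}\|=C_{\infty,q}=\prod_{j=1}^d(1+m_\psi\gamma_j)$.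 2. If $(\mathrm{I}_1)$ holds, then for all $d\ge1$ and $q\in\{1,\infty\}$: $\|\imath_{1,q}\|=\|\imath_{1,q}^{-1}\|=C_{1,q}=\prod_{j=1}^d(1+\kappa_\psi\gamma_j)$. 3. For all $p,q\in[1,\infty]$ such that $(\mathrm{I}_p)$ holds: for every $d\ge1$ the anchored and the ANOVA space are equal as sets and $\|\imath_{p,q}\|=\|\imath_{p,q}^{-1}\|$; the norms are uniformly equivalent if and only if $\sum_{j=1}^\infty\gamma_j<\infty$; if $\sup_{d\ge1}\sum_{j=1}^d\gamma_j/\ln(d+1)<\infty$ then the norms are polynomially equivalent; and the converse of the last implication holds if the sequence $(\gamma_j)_j$ is bounded. -/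

import Mathlib

open MeasureTheory Set
open scoped ENNReal NNReal

namespace AnchoredANOVA

noncomputable section

/-- `D` is an interval `[0,T)` with `0 < T ≤ ∞`, or `[0,T]` with `0 < T < ∞`. -/
def IsAdmissibleDomain (D : Set ℝ) : Prop :=
  (∃ T : ℝ, 0 < T ∧ D = Ico 0 T) ∨ D = Ici 0 ∨ (∃ T : ℝ, 0 < T ∧ D = Icc 0 T)

/-- `ψ` is a probability density on `D` that is positive almost everywhere on `D`.
Only the values of `ψ` on `D` matter, here and below. -/
structure IsPositiveDensity (D : Set ℝ) (ψ : ℝ → ℝ) : Prop where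
  nonneg : ∀ t ∈ D, 0 ≤ ψ t
  pos_ae : ∀ᵐ t ∂(volume.restrict D), 0 < ψ t
  integrable : IntegrableOn ψ D
  integral_eq_one : ∫ t in D, ψ t = 1

/-- The tail `∫_t^T ψ(y) dy` of the density. -/
def tail (D : Set ℝ) (ψ : ℝ → ℝ) (t : ℝ) : ℝ := ∫ y in D ∩ Ioi t, ψ y

/-- The mean `m_ψ = ∫_D y ψ(y) dy`. -/
def mPsi (D : Set ℝ) (ψ : ℝ → ℝ) : ℝ := ∫ y in D, y * ψ y

/-- `κ_ψ`, the `L_∞(D)` norm of the quotient of the tail and the density. -/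
def kappaPsi (D : Set ℝ) (ψ : ℝ → ℝ) : ℝ :=
  (eLpNorm (fun t => tail D ψ t / ψ t) ∞ (volume.restrict D)).toReal

/-- `h` is locally `r`-integrable on `D`: it is in `L_r([0,x))` for all `x ∈ D`. -/
def MemLpLoc (D : Set ℝ) (h : ℝ → ℝ) (r : ℝ≥0∞) : Prop :=
  ∀ x ∈ D, MemLp h r (volume.restrict (Ico 0 x))

/-- The integrability condition on `p` and `ψ` under which the anchored and the ANOVA
spaces are well defined. -/
def IntegrabilityCondition (D : Set ℝ) (ψ : ℝ → ℝ) (p : ℝ≥0∞) : Prop :=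
  (p = ∞ ∧ IntegrableOn (tail D ψ) D) ∨
  (p < ∞ ∧ MemLpLoc D (fun t => ψ t ^ (-(1 / p.toReal))) (ENNReal.conjExponent p) ∧
    MemLp (fun t => tail D ψ t * ψ t ^ (-(1 / p.toReal))) (ENNReal.conjExponent p)
      (volume.restrict D))

/-- The kernel `1_{[0,x)}(t)` of the anchored spaces. -/
def anchoredKernel (x t : ℝ) : ℝ := (Ico 0 x).indicator (fun _ => (1 : ℝ)) t

/-- The kernel `1_{[0,x)}(t) - ∫_t^T ψ` of the ANOVA spaces. -/
def anovaKernel (D : Set ℝ) (ψ : ℝ → ℝ) (x t : ℝ) : ℝ := anchoredKernel x t - tail D ψ t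

/-- The measure `∏_{j ∈ u} ψ(t_j) dt_u` on `D^u`, so that `L_{p,ψ}(D^u)` is `L_p` of this
measure. For `u = ∅` it is the unit mass at the only point. -/
def psiMeasure (D : Set ℝ) (ψ : ℝ → ℝ) {d : ℕ} (u : Finset (Fin d)) : Measure (u → ℝ) :=
  Measure.pi fun _ => (volume.restrict D).withDensity fun t => ENNReal.ofReal (ψ t)

/-- The function `T_u(g)(x) = ∫_{D^u} g(t) ∏_{j ∈ u} K(x_j, t_j) dt` (Lebesgue measure on `D^u`). -/
def superposition (D : Set ℝ) (K : ℝ → ℝ → ℝ) {d : ℕ} (u : Finset (Fin d)) (g : (u → ℝ) → ℝ)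
    (x : Fin d → D) : ℝ :=
  ∫ t : u → ℝ, g t * ∏ j : u, K (x j) (t j) ∂(Measure.pi fun _ => volume.restrict D)

/-- `f = ∑_u T_u(g_u)` on `D^d` with `g_u ∈ L_{p,ψ}(D^u)`, and `g_u = 0` whenever `γ_u = 0`. -/
structure IsDecomposition (D : Set ℝ) (ψ : ℝ → ℝ) (K : ℝ → ℝ → ℝ) (p : ℝ≥0∞) {d : ℕ}
    (γ : Finset (Fin d) → ℝ) (f : (Fin d → D) → ℝ)
    (g : (u : Finset (Fin d)) → (u → ℝ) → ℝ) : Prop where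
  memLp : ∀ u, MemLp (g u) p (psiMeasure D ψ u)
  eq_zero : ∀ u, γ u = 0 → g u =ᵐ[psiMeasure D ψ u] 0
  eq_sum : ∀ x, f x = ∑ u, superposition D K u (g u) x

/-- The `ℓ_q` norm of a finite family of extended non-negative numbers. -/
def lqNorm (q : ℝ≥0∞) {d : ℕ} (a : Finset (Fin d) → ℝ≥0∞) : ℝ≥0∞ :=
  if q = ∞ then ⨆ u, a u else (∑ u, a u ^ q.toReal) ^ (1 / q.toReal)

/-- The weighted space with kernel `K`, as a set of functions on `D^d`: the direct sum of
the spaces `T_u(L_{p,ψ}(D^u))` over all `u` with `γ_u > 0`. -/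
def weightedSpace (D : Set ℝ) (ψ : ℝ → ℝ) (K : ℝ → ℝ → ℝ) (p : ℝ≥0∞) {d : ℕ}
    (γ : Finset (Fin d) → ℝ) : Set ((Fin d → D) → ℝ) :=
  {f | ∃ g, IsDecomposition D ψ K p γ f g}

/-- The weighted norm of `f`: the `ℓ_q` norm of the family `‖g_u‖_{L_{p,ψ}(D^u)} / γ_u`, for the
decomposition `f = ∑_u T_u(g_u)`. The `g_u` are unique as elements of `L_{p,ψ}(D^u)`, so the
infimum is over a single value; it is `∞` if `f` is not in the space. The terms
with `γ_u = 0` are `0 / 0 = 0`. -/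
def weightedNorm (D : Set ℝ) (ψ : ℝ → ℝ) (K : ℝ → ℝ → ℝ) (p q : ℝ≥0∞) {d : ℕ}
    (γ : Finset (Fin d) → ℝ) (f : (Fin d → D) → ℝ) : ℝ≥0∞ :=
  ⨅ (g : (u : Finset (Fin d)) → (u → ℝ) → ℝ) (_ : IsDecomposition D ψ K p γ f g),
    lqNorm q fun u => eLpNorm (g u) p (psiMeasure D ψ u) / ENNReal.ofReal (γ u)

/-- The operator norm of the identity, from the space with kernel `K₁` to the space with
kernel `K₂`; it is `∞` if the first space is not contained in the second one. -/
def idNorm (D : Set ℝ) (ψ : ℝ → ℝ) (K₁ K₂ : ℝ → ℝ → ℝ) (p q : ℝ≥0∞) {d : ℕ}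
    (γ : Finset (Fin d) → ℝ) : ℝ≥0∞ :=
  ⨆ (f : (Fin d → D) → ℝ) (_ : f ∈ weightedSpace D ψ K₁ p γ) (_ : weightedNorm D ψ K₁ p q γ f ≤ 1),
    weightedNorm D ψ K₂ p q γ f

/-- The norm of the embedding `ι` of the ANOVA space into the anchored space. -/
def embNorm (D : Set ℝ) (ψ : ℝ → ℝ) (p q : ℝ≥0∞) {d : ℕ} (γ : Finset (Fin d) → ℝ) : ℝ≥0∞ :=
  idNorm D ψ (anovaKernel D ψ) anchoredKernel p q γ

/-- The norm of the inverse embedding, of the anchored space into the ANOVA space. -/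
def embInvNorm (D : Set ℝ) (ψ : ℝ → ℝ) (p q : ℝ≥0∞) {d : ℕ} (γ : Finset (Fin d) → ℝ) : ℝ≥0∞ :=
  idNorm D ψ anchoredKernel (anovaKernel D ψ) p q γ

/-- The constants `C_{p,q,ψ,γ}`, meaningful for `p, q ∈ {1, ∞}` only:
with `c = m_ψ` if `p = ∞` and `c = κ_ψ` if `p = 1`, it is
`max_u ∑_{v ⊆ uᶜ} c^|v| γ_{u ∪ v} / γ_u` if `q = ∞`, and
`max_v ∑_{u ⊆ v} c^(|v| - |u|) γ_v / γ_u` if `q = 1`. -/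
def extremalConst (D : Set ℝ) (ψ : ℝ → ℝ) (p q : ℝ≥0∞) {d : ℕ} (γ : Finset (Fin d) → ℝ) : ℝ :=
  let c : ℝ := if p = ∞ then mPsi D ψ else kappaPsi D ψ
  if q = ∞ then
    Finset.univ.sup' Finset.univ_nonempty fun u : Finset (Fin d) =>
      ∑ v ∈ uᶜ.powerset, c ^ v.card * (γ (u ∪ v) / γ u)
  else
    Finset.univ.sup' Finset.univ_nonempty fun v : Finset (Fin d) =>
      ∑ u ∈ v.powerset, c ^ (v.card - u.card) * (γ v / γ u)

/-- The anchored and ANOVA norms are uniformly equivalent, for the weights `γ d`, `d ≥ 1`. -/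
def UniformlyEquivalent (D : Set ℝ) (ψ : ℝ → ℝ) (p q : ℝ≥0∞)
    (γ : (d : ℕ) → Finset (Fin d) → ℝ) : Prop :=
  (⨆ (d : ℕ) (_ : 1 ≤ d), embNorm D ψ p q (γ d)) < ∞

/-- The anchored and ANOVA norms are polynomially equivalent: the norm of the embedding is
`O(d^τ)` for some `τ > 0`. -/
def PolynomiallyEquivalent (D : Set ℝ) (ψ : ℝ → ℝ) (p q : ℝ≥0∞)
    (γ : (d : ℕ) → Finset (Fin d) → ℝ) : Prop :=
  ∃ τ : ℝ, 0 < τ ∧ ∃ C : ℝ, ∀ᶠ d : ℕ in Filter.atTop,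
    embNorm D ψ p q (γ d) ≤ ENNReal.ofReal (C * (d : ℝ) ^ τ)

/-- Product weights `γ_u = ∏_{j ∈ u} γ_j`; the coordinates are numbered from `0`. -/
def productWeights (γ : ℕ → ℝ) (d : ℕ) (u : Finset (Fin d)) : ℝ := ∏ j ∈ u, γ j

end

end AnchoredANOVA

/-! Divide both kernels by the density and integrate against the probability measure `ν = ψ(t) dt`.
The normalized kernels then differ by a function of `t` alone: ANOVA equals anchored minus `w`,
where `w` is the tail divided by `ψ`. The condition `(I_p)` puts `w` and the sections of both
kernels into `L_{p'}(ν)`. Since `ν` has mass one, components can be viewed as functions on the whole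
product space that depend only on the coordinates in `u`.

Upper bound: change the kernel one coordinate at a time. Expanding `k' = k + σ w` in coordinate `j`
adds to `g_u`, for `j ∉ u`, the integral of `σ w(t_j) g_{u ∪ {j}}` over `t_j`
(`superpositionSum_switchCoordinate`). By Hölder, Minkowski and `γ_{u ∪ {j}} = γ_j γ_u` this costs a
factor `1 + ‖w‖_{p'} γ_j` (`componentNorm_switchCoordinate_le`), and `exists_switch` multiplies
these factors. Each change is injective on components, so uniqueness of components passes from the
anchored case, where it follows from vanishing integrals over boxes (`isUniqueKernel_anchored`), to
the ANOVA case.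

Equality of the two norms: multiplying `g_u` by `(-1)^|u|` is isometric and turns `σ` into `-σ`, so
it exchanges the embedding and its inverse (`idNorm_le_symm`).

Lower bound: on product functions the change of kernel acts factor by factor
(`KernelSwitch.lqNorm_le`). For a nonnegative pairing `ℓ = ∫ g w dν`, where products of `g` have
norm one, this gives `∏ (1 + ℓ γ_j)` if `q ∈ {1, ∞}`, and `∏ (1 + ℓ γ_j / 2)` for every `q` by
comparing power means. With `g = 1` one gets `ℓ = m_ψ = ‖w‖_1 > 0`, which is sharp for `p = ∞`. For
`p = 1`, normalized indicators of `{w > ℓ}` with `ℓ ↑ κ_ψ` are used. The equivalence criteria follow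
by comparing such products with exponentials of partial sums. -/

namespace AnchoredANOVA

/-! ### Product probability measures and integrating out one coordinate -/

section Coordinates

variable {ι Ω : Type*} [Fintype ι] [DecidableEq ι] [MeasurableSpace Ω] {ν : Measure Ω}
  [IsProbabilityMeasure ν]

/-- Resampling one coordinate independently preserves the law: the preimage of a box has its `j`-th
side moved to the extra factor, and the freed side has mass one. This allows Fubini in a single
coordinate without splitting the index set. -/
theorem measurePreserving_update (ν : Measure Ω) [IsProbabilityMeasure ν] (j : ι) :
    MeasurePreserving (fun z : (ι → Ω) × Ω => Function.update z.1 j z.2)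
      ((Measure.pi fun _ => ν).prod ν) (Measure.pi fun _ => ν) := by
  have hm : Measurable fun z : (ι → Ω) × Ω => Function.update z.1 j z.2 := by
    refine measurable_pi_iff.2 fun i => ?_
    by_cases h : i = j
    · subst h; simpa using measurable_snd
    · simpa [Function.update_of_ne h, Function.comp_def] using
        (measurable_pi_apply i).comp measurable_fst
  refine ⟨hm, (Measure.pi_eq fun s hs => ?_).symm⟩
  rw [Measure.map_apply hm (MeasurableSet.univ_pi hs)]
  have : (fun z : (ι → Ω) × Ω => Function.update z.1 j z.2) ⁻¹' (univ.pi s)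
      = (univ.pi (Function.update s j univ)) ×ˢ s j := by
    ext ⟨t, b⟩
    simp only [mem_preimage, mem_pi, mem_univ, true_implies, mem_prod]
    constructor
    · intro h
      refine ⟨fun i => ?_, by simpa using h j⟩
      by_cases hi : i = j
      · subst hi; simp
      · simpa [hi] using h i
    · rintro ⟨h, hb⟩ i
      by_cases hi : i = j
      · subst hi; simpa using hb
      · simpa [hi] using h i
  rw [this, Measure.prod_prod, Measure.pi_pi, ← Finset.mul_prod_erase _ _ (Finset.mem_univ j),
    ← Finset.mul_prod_erase _ (fun i => ν (s i)) (Finset.mem_univ j)]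
  rw [Function.update_self, measure_univ, one_mul, mul_comm]
  congr 1
  refine Finset.prod_congr rfl fun i hi => ?_
  rw [Function.update_of_ne (Finset.ne_of_mem_erase hi)]

/-- For finite nonzero `r` the `r`-th power factorizes, and coordinates outside `u` contribute the
integral of `1`. For `r = ∞` the essential bounds are multiplied. -/
theorem MemLp.prod_coordinates {r : ℝ≥0∞} {f : ι → Ω → ℝ} {u : Finset ι}
    (hf : ∀ i ∈ u, MemLp (f i) r ν) :
    MemLp (fun t : ι → Ω => ∏ i ∈ u, f i (t i)) r (Measure.pi fun _ => ν) := by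
  have hmeas : ∀ i ∈ u, AEStronglyMeasurable (fun t : ι → Ω => f i (t i))
      (Measure.pi fun _ => ν) := fun i hi =>
    (hf i hi).1.comp_measurePreserving (measurePreserving_eval (fun _ => ν) i)
  have hm : AEStronglyMeasurable (fun t : ι → Ω => ∏ i ∈ u, f i (t i))
      (Measure.pi fun _ => ν) := Finset.aestronglyMeasurable_fun_prod u hmeas
  rcases eq_or_ne r 0 with rfl | h0
  · exact memLp_zero_iff_aestronglyMeasurable.2 hm
  rcases eq_or_ne r ∞ with rfl | htop
  · have hb : ∀ i ∈ u, ∃ C : ℝ, ∀ᵐ t ∂(Measure.pi fun _ : ι => ν), ‖f i (t i)‖ ≤ C := by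
      intro i hi
      refine ⟨(eLpNormEssSup (f i) ν).toReal, ?_⟩
      have := (measurePreserving_eval (fun _ : ι => ν) i).quasiMeasurePreserving.ae
        (ae_le_eLpNormEssSup (f := f i) (μ := ν))
      filter_upwards [this] with t ht
      have hfin : eLpNormEssSup (f i) ν ≠ ∞ := by
        have := (hf i hi).2.ne; rwa [eLpNorm_exponent_top] at this
      have := ENNReal.toReal_mono hfin ht
      simpa using this
    choose! C hC using hb
    refine memLp_top_of_bound hm (∏ i ∈ u, C i) ?_
    have : ∀ᵐ t ∂(Measure.pi fun _ : ι => ν), ∀ i ∈ u, ‖f i (t i)‖ ≤ C i :=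
      (Filter.eventually_all_finset u).2 hC
    filter_upwards [this] with t ht
    rw [norm_prod]
    exact Finset.prod_le_prod (fun i _ => norm_nonneg _) ht
  · rw [← integrable_norm_rpow_iff hm h0 htop]
    have h1 : ∀ i, Integrable (fun x => if i ∈ u then ‖f i x‖ ^ r.toReal else 1) ν := by
      intro i
      by_cases hi : i ∈ u
      · simpa [hi] using (integrable_norm_rpow_iff (hf i hi).1 h0 htop).2 (hf i hi)
      · simp [hi]
    refine (Integrable.fintype_prod (μ := fun _ : ι => ν) h1).congr (ae_of_all _ fun t => ?_)
    simp only [norm_prod]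
    rw [← Real.finsetProd_rpow u _ (fun i _ => norm_nonneg _)]
    simp

/-- The integral of `G · w(t_j)` over the coordinate `t_j`. -/
noncomputable def marginalize (ν : Measure Ω) (w : Ω → ℝ) (j : ι) (G : (ι → Ω) → ℝ)
    (t : ι → Ω) : ℝ := ∫ b, G (Function.update t j b) * w b ∂ν

variable {p r : ℝ≥0∞} {w : Ω → ℝ} {G : (ι → Ω) → ℝ}

theorem aestronglyMeasurable_update_mul (hw : AEStronglyMeasurable w ν)
    (hG : AEStronglyMeasurable G (Measure.pi fun _ => ν)) (j : ι) :
    AEStronglyMeasurable (fun z : (ι → Ω) × Ω => G (Function.update z.1 j z.2) * w z.2)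
      ((Measure.pi fun _ => ν).prod ν) :=
  (hG.comp_measurePreserving (measurePreserving_update ν j)).mul
    (hw.comp_measurePreserving measurePreserving_snd)

/-- Hölder on almost every fibre bounds the marginal by `‖w‖_r` times the `L_p` norm of the fibre.
Taking the `L_p` norm over the base gives back the norm of `G`, because resampling preserves the
measure. -/
theorem eLpNorm_marginalize_le [p.HolderConjugate r] (hp : 1 ≤ p)
    (hw : AEStronglyMeasurable w ν) (hG : AEStronglyMeasurable G (Measure.pi fun _ => ν)) (j : ι) :
    eLpNorm (marginalize ν w j G) p (Measure.pi fun _ => ν)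
      ≤ eLpNorm w r ν * eLpNorm G p (Measure.pi fun _ => ν) := by
  have hΦ := measurePreserving_update ν j
  have hGΦ := hG.comp_measurePreserving hΦ
  have hsec : ∀ᵐ t ∂(Measure.pi fun _ : ι => ν),
      AEStronglyMeasurable (fun b => G (Function.update t j b)) ν := hGΦ.prodMk_left
  have key : ∀ᵐ t ∂(Measure.pi fun _ : ι => ν), ‖marginalize ν w j G t‖ₑ
      ≤ eLpNorm w r ν * eLpNorm (fun b => G (Function.update t j b)) p ν := by
    filter_upwards [hsec] with t ht
    have h1 := eLpNorm_smul_le_mul_eLpNorm (p := r) (q := p) (r := 1) ht hw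
    refine le_trans ?_ h1
    rw [eLpNorm_one_eq_lintegral_enorm]
    refine (enorm_integral_le_lintegral_enorm _).trans (le_of_eq ?_)
    simp [mul_comm]
  rcases eq_or_ne p ∞ with rfl | htop
  · rw [eLpNorm_exponent_top]
    refine essSup_le_of_ae_le _ ?_
    have h2 : ∀ᵐ t ∂(Measure.pi fun _ : ι => ν), ∀ᵐ b ∂ν, ‖G (Function.update t j b)‖ₑ
        ≤ eLpNorm G ∞ (Measure.pi fun _ : ι => ν) := by
      have := hΦ.quasiMeasurePreserving.ae (ae_le_eLpNormEssSup (f := G))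
      simpa [eLpNorm_exponent_top] using Measure.ae_ae_of_ae_prod this
    filter_upwards [key, h2] with t ht h2t
    refine ht.trans ?_
    gcongr
    exact essSup_le_of_ae_le _ h2t
  · have h0 : p ≠ 0 := (zero_lt_one.trans_le hp).ne'
    have hpos : 0 < p.toReal := ENNReal.toReal_pos h0 htop
    have e1 : eLpNorm (marginalize ν w j G) p (Measure.pi fun _ => ν) ^ p.toReal
        ≤ (eLpNorm w r ν * eLpNorm G p (Measure.pi fun _ => ν)) ^ p.toReal := by
      rw [ENNReal.mul_rpow_of_nonneg _ _ hpos.le]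
      have hE : ∀ {α : Type _} [MeasurableSpace α] (f : α → ℝ) (μ : Measure α),
          eLpNorm f p μ ^ p.toReal = ∫⁻ a, ‖f a‖ₑ ^ p.toReal ∂μ := by
        intro α _ f μ
        rw [eLpNorm_eq_lintegral_rpow_enorm_toReal h0 htop, ← ENNReal.rpow_mul,
          one_div_mul_cancel hpos.ne', ENNReal.rpow_one]
      rw [hE]
      calc ∫⁻ t, ‖marginalize ν w j G t‖ₑ ^ p.toReal ∂(Measure.pi fun _ : ι => ν)
          ≤ ∫⁻ t, eLpNorm w r ν ^ p.toReal * ∫⁻ b, ‖G (Function.update t j b)‖ₑ ^ p.toReal ∂ν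
              ∂(Measure.pi fun _ : ι => ν) := by
            refine lintegral_mono_ae ?_
            filter_upwards [key] with t ht
            refine (ENNReal.rpow_le_rpow ht hpos.le).trans (le_of_eq ?_)
            rw [ENNReal.mul_rpow_of_nonneg _ _ hpos.le]
            congr 1
            rw [eLpNorm_eq_lintegral_rpow_enorm_toReal h0 htop, ← ENNReal.rpow_mul,
              one_div_mul_cancel hpos.ne', ENNReal.rpow_one]
        _ = eLpNorm w r ν ^ p.toReal * ∫⁻ z, ‖G (Function.update z.1 j z.2)‖ₑ ^ p.toReal
              ∂((Measure.pi fun _ : ι => ν).prod ν) := by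
            have hm : AEMeasurable (fun z : (ι → Ω) × Ω =>
                ‖G (Function.update z.1 j z.2)‖ₑ ^ p.toReal)
                ((Measure.pi fun _ : ι => ν).prod ν) := hGΦ.enorm.pow_const _
            rw [lintegral_const_mul'' _ hm.lintegral_prod_right', lintegral_prod _ hm]
        _ = _ := by
            congr 1
            rw [← eLpNorm_comp_measurePreserving hG hΦ,
              eLpNorm_eq_lintegral_rpow_enorm_toReal h0 htop, ← ENNReal.rpow_mul,
              one_div_mul_cancel hpos.ne', ENNReal.rpow_one]
            rfl
    exact (ENNReal.rpow_le_rpow_iff hpos).1 e1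

theorem MemLp.marginalize [p.HolderConjugate r] (hp : 1 ≤ p) (hw : MemLp w r ν)
    (hG : MemLp G p (Measure.pi fun _ => ν)) (j : ι) :
    MemLp (marginalize ν w j G) p (Measure.pi fun _ => ν) :=
  ⟨(aestronglyMeasurable_update_mul hw.1 hG.1 j).integral_prod_right',
    (eLpNorm_marginalize_le hp hw.1 hG.1 j).trans_lt (ENNReal.mul_lt_top hw.2 hG.2)⟩

theorem marginalize_ae_eq_zero (hG : G =ᵐ[Measure.pi fun _ => ν] 0) (j : ι) :
    marginalize ν w j G =ᵐ[Measure.pi fun _ => ν] 0 := by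
  have := Measure.ae_ae_of_ae_prod ((measurePreserving_update ν j).quasiMeasurePreserving.ae hG)
  filter_upwards [this] with t ht
  refine integral_eq_zero_of_ae ?_
  filter_upwards [ht] with b hb
  simpa using Or.inl hb

/-- Fubini's theorem for the coordinate `j`. -/
theorem integral_mul_coordinate_mul
    {H : (ι → Ω) → ℝ} {j : ι} (hH : DependsOn H {j}ᶜ)
    (hint : Integrable (fun t => G t * w (t j) * H t) (Measure.pi fun _ => ν)) :
    ∫ t, G t * w (t j) * H t ∂(Measure.pi fun _ => ν)
      = ∫ t, marginalize ν w j G t * H t ∂(Measure.pi fun _ => ν) := by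
  have hΦ := measurePreserving_update ν j
  have hc := hΦ.integrable_comp_of_integrable hint
  rw [← hΦ.map_eq, integral_map hΦ.measurable.aemeasurable (by rw [hΦ.map_eq]; exact hint.1),
    hΦ.map_eq]
  refine (integral_prod _ hc).trans (integral_congr_ae (ae_of_all _ fun t => ?_))
  simp only [marginalize]
  rw [← integral_mul_const]
  congr 1; ext b
  simp only [Function.comp_apply]
  rw [Function.update_self, hH (x := Function.update t j b) (y := t)]
  intro i hi
  exact Function.update_of_ne hi _ _

end Coordinates

theorem dependsOn_marginalize {ι Ω : Type*} [DecidableEq ι] [MeasurableSpace Ω]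
    {ν : Measure Ω} {w : Ω → ℝ} {G : (ι → Ω) → ℝ} {u : Finset ι} {j : ι}
    (hG : DependsOn G (insert j u : Finset ι)) :
    DependsOn (marginalize ν w j G) u := by
  intro s t hst
  simp only [marginalize]
  congr 1; ext b; congr 1
  refine hG fun i hi => ?_
  by_cases hij : i = j
  · subst hij; simp
  · simp only [Function.update_of_ne hij]
    exact hst i (by simpa [hij] using hi)

/-! ### The `ℓ_q` norm of families indexed by subsets -/

section LqNorm

variable {q : ℝ≥0∞} {d : ℕ} {a b : Finset (Fin d) → ℝ≥0∞}

theorem lqNorm_mono (h : ∀ u, a u ≤ b u) : lqNorm q a ≤ lqNorm q b := by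
  unfold lqNorm
  split_ifs
  · exact iSup_mono h
  · gcongr with u
    exact h u

theorem toReal_pos_of_one_le (hq : 1 ≤ q) (h : q ≠ ∞) : 0 < q.toReal :=
  ENNReal.toReal_pos (zero_lt_one.trans_le hq).ne' h

theorem lqNorm_add_le (hq : 1 ≤ q) : lqNorm q (fun u => a u + b u) ≤ lqNorm q a + lqNorm q b := by
  unfold lqNorm
  split_ifs with h
  · exact iSup_le fun u => add_le_add (le_iSup a u) (le_iSup b u)
  · refine ENNReal.Lp_add_le _ _ _ ?_
    simpa using ENNReal.toReal_mono h hq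

theorem lqNorm_const_mul (hq : 1 ≤ q) (c : ℝ≥0∞) :
    lqNorm q (fun u => c * a u) = c * lqNorm q a := by
  unfold lqNorm
  split_ifs with h
  · rw [ENNReal.mul_iSup]
  · have hpos := toReal_pos_of_one_le hq h
    simp_rw [ENNReal.mul_rpow_of_nonneg _ _ hpos.le]
    rw [← Finset.mul_sum, ENNReal.mul_rpow_of_nonneg _ _ (by positivity), ← ENNReal.rpow_mul,
      mul_one_div_cancel hpos.ne', ENNReal.rpow_one]

/-- `u ↦ insert j u` is injective on the sets that miss `j`, so up to zeros the left family is a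
subfamily of `a`. -/
theorem lqNorm_insert_le (hq : 1 ≤ q) (j : Fin d) :
    lqNorm q (fun u => if j ∈ u then 0 else a (insert j u)) ≤ lqNorm q a := by
  unfold lqNorm
  split_ifs with h
  · refine iSup_le fun u => ?_
    dsimp only
    split_ifs
    · exact zero_le
    · exact le_iSup a _
  · have hpos := toReal_pos_of_one_le hq h
    refine ENNReal.rpow_le_rpow ?_ (by positivity)
    have : ∀ u : Finset (Fin d), (if j ∈ u then 0 else a (insert j u)) ^ q.toReal
        = if j ∉ u then a (insert j u) ^ q.toReal else 0 := by
      intro u; by_cases hu : j ∈ u <;> simp [hu, hpos]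
    simp_rw [this]
    rw [← Finset.sum_filter]
    calc _ = ∑ v ∈ ({u | j ∉ u} : Finset (Finset (Fin d))).image (insert j), a v ^ q.toReal := by
          rw [Finset.sum_image]
          intro u hu v hv huv
          simp only [Finset.coe_filter, Finset.mem_univ, true_and, mem_ofPred_eq] at hu hv
          rw [← Finset.erase_insert hu, huv, Finset.erase_insert hv]
      _ ≤ _ := Finset.sum_le_sum_of_subset (Finset.subset_univ _)

end LqNorm

/-! ### Changing the kernel one coordinate at a time -/

/-- The sum over `u` of the superpositions of `G u`, for functions on the full product space and a
kernel `k j` for each coordinate `j`. -/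
noncomputable def superpositionSum {X : Type*} (ν : Measure ℝ) {d : ℕ} (k : Fin d → X → ℝ → ℝ)
    (G : Finset (Fin d) → (Fin d → ℝ) → ℝ) (x : Fin d → X) : ℝ :=
  ∑ u, ∫ t, G u t * ∏ j ∈ u, k j (x j) (t j) ∂(Measure.pi fun _ => ν)

/-- `G u` is an `L_p` function of the coordinates in `u`, for every `u`. -/
structure IsComponentFamily (ν : Measure ℝ) (p : ℝ≥0∞) {d : ℕ}
    (G : Finset (Fin d) → (Fin d → ℝ) → ℝ) : Prop where
  memLp : ∀ u, MemLp (G u) p (Measure.pi fun _ => ν)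
  dependsOn : ∀ u, DependsOn (G u) u

/-- The effect on the components of removing the summand `σ w` from the kernel of the
coordinate `j`. -/
noncomputable def switchCoordinate (ν : Measure ℝ) (w : ℝ → ℝ) {d : ℕ} (j : Fin d) (σ : ℝ)
    (G : Finset (Fin d) → (Fin d → ℝ) → ℝ) (u : Finset (Fin d)) (t : Fin d → ℝ) : ℝ :=
  if j ∈ u then G u t else G u t + σ * marginalize ν w j (G (insert j u)) t

/-- The components with the signs `(-1)^|u|`. -/
def alternate {d : ℕ} (G : Finset (Fin d) → (Fin d → ℝ) → ℝ) (u : Finset (Fin d))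
    (t : Fin d → ℝ) : ℝ := (-1) ^ u.card * G u t

section Switch

variable {X : Type*} {ν : Measure ℝ} [IsProbabilityMeasure ν] {p r : ℝ≥0∞} {d : ℕ} {w : ℝ → ℝ}
  {j : Fin d} {σ : ℝ} {G : Finset (Fin d) → (Fin d → ℝ) → ℝ}

theorem IsComponentFamily.switchCoordinate [p.HolderConjugate r] (hp : 1 ≤ p) (hw : MemLp w r ν)
    (hG : IsComponentFamily ν p G) : IsComponentFamily ν p (switchCoordinate ν w j σ G) where
  memLp u := by
    unfold AnchoredANOVA.switchCoordinate
    by_cases hj : j ∈ u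
    · simpa [hj] using hG.memLp u
    · simp only [hj, if_false]
      exact (hG.memLp u).add
        ((MemLp.marginalize hp hw (hG.memLp (insert j u)) j).const_mul σ)
  dependsOn u := by
    intro s t hst
    simp only [AnchoredANOVA.switchCoordinate]
    rw [hG.dependsOn u hst, dependsOn_marginalize (by exact hG.dependsOn (insert j u)) hst]

omit [IsProbabilityMeasure ν] in
theorem IsComponentFamily.alternate (hG : IsComponentFamily ν p G) :
    IsComponentFamily ν p (alternate G) where
  memLp u := (hG.memLp u).const_mul _
  dependsOn u s t hst := by simp only [AnchoredANOVA.alternate, hG.dependsOn u hst]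

-- Inserting `j` changes the parity of `|u|`, so conjugation by the signs reverses the sign of the
-- off-diagonal term. This is the source of the equality of the two embedding norms.
omit [IsProbabilityMeasure ν] in
theorem alternate_switchCoordinate :
    alternate (switchCoordinate ν w j σ G) = switchCoordinate ν w j (-σ) (alternate G) := by
  ext u t
  by_cases hj : j ∈ u
  · simp [alternate, switchCoordinate, hj]
  · have : marginalize ν w j (alternate G (insert j u)) t
        = (-1) ^ (u.card + 1) * marginalize ν w j (G (insert j u)) t := by
      simp only [marginalize, alternate, Finset.card_insert_of_notMem hj, mul_assoc]
      rw [integral_const_mul]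
    simp only [switchCoordinate, hj, if_false, this]
    simp only [alternate, switchCoordinate, hj, if_false]
    ring

/-- The change of components is unitriangular: those with `j ∈ u` are untouched, and the others
receive only a contribution from these. -/
theorem switchCoordinate_ae_eq_zero (h : ∀ u, switchCoordinate ν w j σ G u
    =ᵐ[Measure.pi fun _ => ν] 0) (u : Finset (Fin d)) : G u =ᵐ[Measure.pi fun _ => ν] 0 := by
  have h1 : ∀ u, j ∈ u → G u =ᵐ[Measure.pi fun _ => ν] 0 := by
    intro u hu
    filter_upwards [h u] with t ht
    simpa [switchCoordinate, hu] using ht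
  by_cases hu : j ∈ u
  · exact h1 u hu
  · filter_upwards [h u, marginalize_ae_eq_zero (w := w) (h1 (insert j u) (by simp)) j]
      with t ht ht2
    simpa [switchCoordinate, hu, ht2] using ht

theorem integrable_mul_prod_kernel [p.HolderConjugate r] {F : (Fin d → ℝ) → ℝ}
    (hF : MemLp F p (Measure.pi fun _ => ν)) {u : Finset (Fin d)} {f : Fin d → ℝ → ℝ}
    (hf : ∀ i ∈ u, MemLp (f i) r ν) :
    Integrable (fun t => F t * ∏ i ∈ u, f i (t i)) (Measure.pi fun _ => ν) :=
  hF.integrable_mul (MemLp.prod_coordinates hf)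

/-- Expand the factor of coordinate `j`. In the term with `σ w(t_j)` that coordinate can be
integrated out, which leaves a superposition over `u \ {j}`. Reindexing by `u ↔ u \ {j}` collects
these terms in the components without `j`. -/
theorem superpositionSum_switchCoordinate [p.HolderConjugate r] (hp : 1 ≤ p) (hw : MemLp w r ν)
    (hG : IsComponentFamily ν p G) {k k' : Fin d → X → ℝ → ℝ} (hk : ∀ i x, MemLp (k i x) r ν)
    (hne : ∀ i, i ≠ j → k' i = k i) (hj : ∀ x t, k' j x t = k j x t + σ * w t) (x : Fin d → X) :
    superpositionSum ν k' G x = superpositionSum ν k (switchCoordinate ν w j σ G) x := by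
  set A : Finset (Fin d) → ℝ := fun u =>
    ∫ t, G u t * ∏ i ∈ u, k i (x i) (t i) ∂(Measure.pi fun _ => ν) with hA
  set B : Finset (Fin d) → ℝ := fun u =>
    ∫ t, marginalize ν w j (G u) t * ∏ i ∈ u.erase j, k i (x i) (t i) ∂(Measure.pi fun _ => ν)
    with hB
  have hl : ∀ u, ∫ t, G u t * ∏ i ∈ u, k' i (x i) (t i) ∂(Measure.pi fun _ => ν)
      = A u + if j ∈ u then σ * B u else 0 := by
    intro u
    by_cases hu : j ∈ u
    · have hi : Integrable (fun t => G u t * w (t j) * ∏ i ∈ u.erase j, k i (x i) (t i))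
          (Measure.pi fun _ => ν) := by
        -- The term with `w` is again a product-kernel integrand, with `w` in the place of the
        -- kernel of coordinate `j`.
        have := integrable_mul_prod_kernel (r := r) (hG.memLp u) (u := u)
          (f := Function.update (fun i => k i (x i)) j w) (fun i _ => by
            by_cases hij : i = j
            · rw [hij]; simpa using hw
            · simpa [hij] using hk i (x i))
        refine this.congr (ae_of_all _ fun t => ?_)
        simp only
        rw [← Finset.mul_prod_erase u _ hu, Function.update_self, mul_assoc]
        congr 2
        refine Finset.prod_congr rfl fun i hi => ?_
        rw [Function.update_of_ne (Finset.ne_of_mem_erase hi)]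
      have hd : DependsOn (fun t : Fin d → ℝ => ∏ i ∈ u.erase j, k i (x i) (t i)) {j}ᶜ := by
        intro s t hst
        refine Finset.prod_congr rfl fun i hi => ?_
        rw [hst i (by simpa using Finset.ne_of_mem_erase hi)]
      simp only [hu, if_true, hA, hB]
      rw [← integral_mul_coordinate_mul hd hi, ← integral_const_mul, ← integral_add
        (integrable_mul_prod_kernel (hG.memLp u) fun i _ => hk i (x i)) (hi.const_mul σ)]
      congr 1; ext t
      rw [← Finset.mul_prod_erase u _ hu, ← Finset.mul_prod_erase u (fun i => k i (x i) (t i)) hu,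
        hj, Finset.prod_congr rfl fun i hi => by rw [hne i (Finset.ne_of_mem_erase hi)]]
      ring
    · simp only [hu, if_false, add_zero, hA]
      congr 1; ext t; congr 1
      refine Finset.prod_congr rfl fun i hi => ?_
      rw [hne i (fun h => hu (h ▸ hi))]
  have hr : ∀ u, ∫ t, switchCoordinate ν w j σ G u t * ∏ i ∈ u, k i (x i) (t i)
      ∂(Measure.pi fun _ => ν) = A u + if j ∈ u then 0 else σ * B (insert j u) := by
    intro u
    by_cases hu : j ∈ u
    · simp [switchCoordinate, hu, hA]
    · simp only [switchCoordinate, hu, if_false, hA, hB, Finset.erase_insert hu]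
      rw [← integral_const_mul, ← integral_add
        (integrable_mul_prod_kernel (hG.memLp u) fun i _ => hk i (x i))
        ((integrable_mul_prod_kernel (MemLp.marginalize hp hw (hG.memLp (insert j u)) j)
          fun i _ => hk i (x i)).const_mul σ)]
      congr 1; ext t; ring
  simp only [superpositionSum, hl, hr, Finset.sum_add_distrib]
  congr 1
  have e : ∀ u : Finset (Fin d), (if j ∈ u then 0 else σ * B (insert j u))
      = if j ∉ u then σ * B (insert j u) else 0 := fun u => by by_cases hu : j ∈ u <;> simp [hu]
  simp_rw [e]
  rw [← Finset.sum_filter, ← Finset.sum_filter]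
  refine Finset.sum_bij' (fun u _ => u.erase j) (fun u _ => insert j u) ?_ ?_ ?_ ?_ ?_
  · simp
  · simp
  · intro u hu; exact Finset.insert_erase (by simpa using hu)
  · intro u hu; exact Finset.erase_insert (by simpa using hu)
  · intro u hu; rw [Finset.insert_erase (by simpa using hu)]

/-- The `ℓ_q` norm of the weighted `L_p` norms of the components. -/
noncomputable def componentNorm (ν : Measure ℝ) (p q : ℝ≥0∞) {d : ℕ} (γ : Finset (Fin d) → ℝ)
    (G : Finset (Fin d) → (Fin d → ℝ) → ℝ) : ℝ≥0∞ :=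
  lqNorm q fun u => eLpNorm (G u) p (Measure.pi fun _ => ν) / ENNReal.ofReal (γ u)

omit [IsProbabilityMeasure ν] in
theorem componentNorm_alternate (q : ℝ≥0∞) (γ : Finset (Fin d) → ℝ) :
    componentNorm ν p q γ (alternate G) = componentNorm ν p q γ G := by
  unfold componentNorm
  congr 1; ext u; congr 1
  refine eLpNorm_congr_norm_ae (ae_of_all _ fun t => ?_)
  simp [alternate]

/-- The added term has norm at most `‖w‖_r ‖G_{u ∪ {j}}‖_p`. Dividing by `γ_u = γ_{u ∪ {j}} / γ_j`
gives the factor `γ_j`, and Minkowski in `ℓ_q` separates the two families. -/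
theorem componentNorm_switchCoordinate_le [p.HolderConjugate r] (hp : 1 ≤ p) {q : ℝ≥0∞}
    (hq : 1 ≤ q) (hw : MemLp w r ν) (hσ : |σ| ≤ 1) (hG : IsComponentFamily ν p G) {γ : ℕ → ℝ}
    (hγ : ∀ i, 0 < γ i) :
    componentNorm ν p q (productWeights γ d) (switchCoordinate ν w j σ G)
      ≤ (1 + eLpNorm w r ν * ENNReal.ofReal (γ j)) * componentNorm ν p q (productWeights γ d) G := by
  have hpos : ∀ u : Finset (Fin d), 0 < productWeights γ d u :=
    fun u => Finset.prod_pos fun i _ => hγ i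
  set a : Finset (Fin d) → ℝ≥0∞ := fun u =>
    eLpNorm (G u) p (Measure.pi fun _ => ν) / ENNReal.ofReal (productWeights γ d u) with ha
  have h1 : ∀ u, eLpNorm (switchCoordinate ν w j σ G u) p (Measure.pi fun _ => ν)
      / ENNReal.ofReal (productWeights γ d u)
      ≤ a u + eLpNorm w r ν * ENNReal.ofReal (γ j) * (if j ∈ u then 0 else a (insert j u)) := by
    intro u
    by_cases hu : j ∈ u
    · have : switchCoordinate ν w j σ G u = G u := by ext t; simp [switchCoordinate, hu]
      simp [this, hu, ha]
    · have e : switchCoordinate ν w j σ G u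
          = G u + fun t => σ * marginalize ν w j (G (insert j u)) t := by
        ext t; simp [switchCoordinate, hu]
      have hm := MemLp.marginalize hp hw (hG.memLp (insert j u)) j
      have hwt : productWeights γ d (insert j u) = γ j * productWeights γ d u := by
        simp [productWeights, Finset.prod_insert hu]
      have hγ0 : ENNReal.ofReal (γ j) ≠ 0 := by simpa using hγ j
      have h2 : eLpNorm (fun t => σ * marginalize ν w j (G (insert j u)) t) p
          (Measure.pi fun _ => ν)
          ≤ eLpNorm w r ν * eLpNorm (G (insert j u)) p (Measure.pi fun _ => ν) := by
        refine le_trans (eLpNorm_mono fun t => ?_)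
          (eLpNorm_marginalize_le hp hw.1 (hG.memLp (insert j u)).1 j)
        rw [norm_mul]
        exact mul_le_of_le_one_left (norm_nonneg _) hσ
      rw [e, if_neg hu]
      refine (ENNReal.div_le_div_right ((eLpNorm_add_le (hG.memLp u).1 (hm.1.const_mul σ) hp).trans
        (add_le_add le_rfl h2)) _).trans ?_
      rw [ENNReal.add_div]
      simp only [ha]
      gcongr
      rw [hwt, ENNReal.ofReal_mul (hγ j).le, mul_assoc, mul_div_assoc]
      gcongr
      rw [← mul_div_assoc, ENNReal.mul_div_mul_left _ _ hγ0 ENNReal.ofReal_ne_top]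
  calc _ ≤ _ := lqNorm_mono h1
    _ ≤ _ := lqNorm_add_le hq
    _ ≤ _ := by
      rw [lqNorm_const_mul hq, add_mul, one_mul]
      gcongr
      · exact le_rfl
      · exact lqNorm_insert_le hq j

/-- Passing from the kernel `b = a + σ w` to the kernel `a` in the coordinates of `S`. -/
theorem exists_switch [p.HolderConjugate r] (hp : 1 ≤ p) (hw : MemLp w r ν) (hσ : |σ| ≤ 1)
    {a b : X → ℝ → ℝ} (ha : ∀ x, MemLp (a x) r ν) (hb : ∀ x, MemLp (b x) r ν)
    (hab : ∀ x t, b x t = a x t + σ * w t) {γ : ℕ → ℝ} (hγ : ∀ i, 0 < γ i)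
    (hG : IsComponentFamily ν p G) (S : Finset (Fin d)) :
    ∃ H, IsComponentFamily ν p H ∧
      superpositionSum ν (fun _ => b) G
        = superpositionSum ν (fun i => if i ∈ S then a else b) H ∧
      superpositionSum ν (fun _ => a) (alternate G)
        = superpositionSum ν (fun i => if i ∈ S then b else a) (alternate H) ∧
      (∀ q, 1 ≤ q → componentNorm ν p q (productWeights γ d) H
        ≤ (∏ i ∈ S, (1 + eLpNorm w r ν * ENNReal.ofReal (γ i)))
          * componentNorm ν p q (productWeights γ d) G) ∧
      ((∀ u, H u =ᵐ[Measure.pi fun _ => ν] 0) → ∀ u, G u =ᵐ[Measure.pi fun _ => ν] 0) := by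
  induction S using Finset.induction_on with
  | empty => exact ⟨G, hG, by simp, by simp, by simp, id⟩
  | insert j S hjS ih =>
    obtain ⟨H, hH, h1, h2, h3, h4⟩ := ih
    refine ⟨switchCoordinate ν w j σ H, hH.switchCoordinate hp hw, ?_, ?_, ?_, ?_⟩
    · rw [h1]
      ext x
      refine superpositionSum_switchCoordinate hp hw hH (fun i x => ?_) (fun i hi => ?_)
        (fun x t => ?_) x
      · split_ifs
        exacts [ha x, hb x]
      · simp [hi]
      · simp [hjS, hab]
    -- The signs turn the step into one with `-σ`, which is the step from `a = b - σ w` to `b`: the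
    -- same components undo the change of kernel.
    · rw [h2, alternate_switchCoordinate]
      ext x
      refine superpositionSum_switchCoordinate hp hw hH.alternate (fun i x => ?_) (fun i hi => ?_)
        (fun x t => ?_) x
      · split_ifs
        exacts [hb x, ha x]
      · simp [hi]
      · simp [hjS, hab]
    · intro q hq
      rw [Finset.prod_insert hjS, mul_assoc]
      exact (componentNorm_switchCoordinate_le hp hq hw hσ hH hγ).trans (by gcongr; exact h3 q hq)
    · exact fun h => h4 (switchCoordinate_ae_eq_zero h)

end Switch

/-! ### Passing between `u`-coordinates and the full product space -/

section Restriction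

variable {ι Ω : Type*} [Fintype ι] [DecidableEq ι] [MeasurableSpace Ω] {ν : Measure Ω}
  [IsProbabilityMeasure ν]

theorem measurePreserving_finsetRestrict (ν : Measure Ω) [IsProbabilityMeasure ν] (u : Finset ι) :
    MeasurePreserving (u.restrict : (ι → Ω) → u → Ω) (Measure.pi fun _ => ν)
      (Measure.pi fun _ => ν) := by
  convert! measurePreserving_fst.comp (measurePreserving_piEquivPiSubtypeProd (fun _ => ν) (· ∈ u))

/-- Freeze the coordinates outside `u` at a point `b`. Measurability of the section is only
guaranteed for almost every `b`, so `b` is picked from a set of full measure. -/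
theorem exists_memLp_comp_restrict {p : ℝ≥0∞} {u : Finset ι} {G : (ι → Ω) → ℝ}
    (hG : MemLp G p (Measure.pi fun _ => ν)) (hd : DependsOn G u) :
    ∃ g : (u → Ω) → ℝ, MemLp g p (Measure.pi fun _ => ν) ∧ ∀ t, G t = g (u.restrict t) := by
  have he := (measurePreserving_piEquivPiSubtypeProd (fun _ : ι => ν) (· ∈ u)).symm
  obtain ⟨b, hb⟩ := (hG.1.comp_measurePreserving he).prodMk_right.exists
  set e := (MeasurableEquiv.piEquivPiSubtypeProd (fun _ : ι => Ω) (· ∈ u))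
  have hg : ∀ t, G t = G (e.symm (u.restrict t, b)) := by
    refine fun t => hd fun i hi => ?_
    have hi' : i ∈ u := hi
    simp [e, MeasurableEquiv.piEquivPiSubtypeProd, Equiv.piEquivPiSubtypeProd, hi']
  have hb' : AEStronglyMeasurable (fun s => G (e.symm (s, b))) (Measure.pi fun _ : u => ν) := by
    convert! hb
  refine ⟨fun s => G (e.symm (s, b)), ⟨hb', ?_⟩, hg⟩
  have hr := measurePreserving_finsetRestrict ν u
  rw [← eLpNorm_comp_measurePreserving hb' hr]
  convert hG.2 using 2
  ext t; exact (hg t).symm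

end Restriction

/-- Products of half-lines form a π-system generating the Borel sets, and their traces on a large
box are anchored boxes. By Dynkin's argument the integral of `F` vanishes on every measurable part
of that box; complements cause no problem as the integral over the large box itself is zero. The
large boxes exhaust almost everything. -/
theorem ae_eq_zero_of_integral_boxes {ι : Type*} [Fintype ι] {m : Measure (ι → ℝ)} {D : Set ℝ}
    (hD : ∀ x ∈ D, 0 ≤ x) (hD' : ∀ x ∈ D, ∀ z, 0 ≤ z → z ≤ x → z ∈ D) {F : (ι → ℝ) → ℝ} {x : ℕ → ℝ}
    (hx : ∀ n, x n ∈ D) (hae : ∀ᵐ t ∂m, ∃ n, t ∈ univ.pi fun _ => Ico 0 (x n))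
    (hF : ∀ n, IntegrableOn F (univ.pi fun _ => Ico 0 (x n)) m)
    (h0 : ∀ y : ι → ℝ, (∀ i, y i ∈ D) → ∫ t in univ.pi (fun i => Ico 0 (y i)), F t ∂m = 0) :
    F =ᵐ[m] 0 := by
  have key : ∀ n, F =ᵐ[m.restrict (univ.pi fun _ => Ico 0 (x n))] 0 := by
    intro n
    set B : Set (ι → ℝ) := univ.pi fun _ => Ico 0 (x n) with hB
    refine (hF n).ae_eq_zero_of_forall_setIntegral_eq_zero fun s hs _ => ?_
    have hgen : (MeasurableSpace.pi : MeasurableSpace (ι → ℝ))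
        = MeasurableSpace.generateFrom (univ.pi '' univ.pi fun _ : ι => range (Iio : ℝ → Set ℝ)) := by
      refine (generateFrom_eq_pi (fun i => ?_) fun i => ?_).symm
      · rw [← borel_eq_generateFrom_Iio]; exact (BorelSpace.measurable_eq (α := ℝ)).symm
      · refine ⟨fun n : ℕ => Iio (n : ℝ), fun n => mem_range_self _, ?_⟩
        exact eq_univ_of_forall fun y => mem_iUnion.2 ((exists_nat_gt y).imp fun n hn => hn)
    refine MeasurableSpace.induction_on_inter
      (C := fun s _ => ∫ t in s, F t ∂(m.restrict B) = 0) hgen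
      (IsPiSystem.pi fun _ => isPiSystem_Iio) ?_ ?_ ?_ ?_ s hs
    · simp
    · rintro _ ⟨S, hS, rfl⟩
      have hS' : ∀ i, ∃ y, Iio y = S i := fun i => hS i (mem_univ i)
      choose y hy using hS'
      rw [Measure.restrict_restrict (MeasurableSet.univ_pi fun i => by
        rw [← hy i]; exact measurableSet_Iio)]
      -- The maximum with `0` covers negative `y i`: the side is then empty and its end point still
      -- lies in `D`.
      have : univ.pi S ∩ B = univ.pi fun i => Ico 0 (max 0 (min (y i) (x n))) := by
        rw [hB, ← pi_inter_distrib]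
        congr 1; ext i z
        rw [← hy i]
        simp only [mem_inter_iff, mem_Iio, mem_Ico, lt_max_iff, lt_min_iff]
        constructor
        · rintro ⟨a, b, c⟩; exact ⟨b, Or.inr ⟨a, c⟩⟩
        · rintro ⟨a, b | b⟩
          · exact absurd a (not_le.2 b)
          · exact ⟨b.1, a, b.2⟩
      rw [this]
      exact h0 _ fun i => hD' _ (hx n) _ (le_max_left _ _)
        (max_le (hD _ (hx n)) (min_le_right _ _))
    · intro t ht h
      have h1 := integral_add_compl ht (hF n)
      rw [h, zero_add] at h1
      rw [h1]
      exact h0 _ fun _ => hx n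
    · intro f hd hm h
      have := hasSum_integral_iUnion hm hd (hF n).integrableOn
      rw [funext (f := fun i => ∫ t in f i, F t ∂(m.restrict B)) (g := fun _ => 0) h] at this
      exact this.unique hasSum_zero
  have hmB : ∀ n, MeasurableSet (univ.pi fun _ : ι => Ico 0 (x n)) := fun n =>
    MeasurableSet.univ_pi fun _ => measurableSet_Ico
  have key' : ∀ᵐ t ∂m, ∀ n, t ∈ (univ.pi fun _ : ι => Ico 0 (x n)) → F t = 0 :=
    ae_all_iff.2 fun n => (ae_restrict_iff' (hmB n)).1 (key n)
  filter_upwards [hae, key'] with t ⟨n, hn⟩ ht using ht n hn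

/-- On boxes this is Fubini for a product of functions of one variable. Finiteness of the weighted
measure makes the density integrable, so real-valued integrals can be used. -/
theorem pi_withDensity {ι Ω : Type*} [Fintype ι] [MeasurableSpace Ω] {μ : Measure Ω} [SigmaFinite μ]
    {ρ : Ω → ℝ≥0} (hρ : Measurable ρ) [IsFiniteMeasure (μ.withDensity fun t => ρ t)] :
    (Measure.pi fun _ : ι => μ.withDensity fun t => ρ t)
      = (Measure.pi fun _ : ι => μ).withDensity fun t => ((∏ i, ρ (t i) : ℝ≥0) : ℝ≥0∞) := by
  refine Measure.pi_eq fun s hs => ?_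
  have hint : ∀ i, Integrable ((s i).indicator fun t => (ρ t : ℝ)) μ := fun i => by
    refine Integrable.indicator ⟨hρ.coe_nnreal_real.aestronglyMeasurable, ?_⟩ (hs i)
    rw [hasFiniteIntegral_iff_enorm]
    have := measure_lt_top (μ.withDensity fun t => ρ t) univ
    rw [withDensity_apply _ MeasurableSet.univ, Measure.restrict_univ] at this
    simpa using this
  have hnn : ∀ i t, 0 ≤ (s i).indicator (fun t => (ρ t : ℝ)) t := fun i t =>
    indicator_nonneg (fun _ _ => NNReal.coe_nonneg _) t
  have h1 : ∀ i, (μ.withDensity fun t => (ρ t : ℝ≥0∞)) (s i)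
      = ENNReal.ofReal (∫ t, (s i).indicator (fun t => (ρ t : ℝ)) t ∂μ) := by
    intro i
    rw [withDensity_apply _ (hs i), ofReal_integral_eq_lintegral_ofReal (hint i)
      (ae_of_all _ (hnn i)), ← lintegral_indicator (hs i)]
    congr 1; ext t
    by_cases h : t ∈ s i <;> simp [h]
  simp_rw [h1]
  rw [withDensity_apply _ (MeasurableSet.univ_pi hs), ← lintegral_indicator (MeasurableSet.univ_pi hs),
    ← ENNReal.ofReal_prod_of_nonneg fun i _ => integral_nonneg (hnn i),
    ← integral_fintype_prod_eq_prod, ofReal_integral_eq_lintegral_ofReal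
      (Integrable.fintype_prod hint) (ae_of_all _ fun t => Finset.prod_nonneg fun i _ => hnn i _)]
  congr 1; ext t
  by_cases h : t ∈ univ.pi s
  · have h' : ∀ i, t i ∈ s i := fun i => h i (mem_univ i)
    rw [indicator_of_mem h, Finset.prod_congr rfl fun i _ => indicator_of_mem (h' i) _]
    rw [← NNReal.coe_prod, ENNReal.ofReal_coe_nnreal]
  · rw [indicator_of_notMem h]
    simp only [mem_pi, mem_univ, true_implies, not_forall] at h
    obtain ⟨i, hi⟩ := h
    rw [Finset.prod_eq_zero (Finset.mem_univ i) (indicator_of_notMem hi _), ENNReal.ofReal_zero]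

/-! ### The interval `D` -/

namespace IsAdmissibleDomain

variable {D : Set ℝ}

theorem measurableSet (hD : IsAdmissibleDomain D) : MeasurableSet D := by
  rcases hD with ⟨T, -, rfl⟩ | rfl | ⟨T, -, rfl⟩ <;> measurability

theorem nonneg (hD : IsAdmissibleDomain D) : ∀ x ∈ D, 0 ≤ x := by
  rcases hD with ⟨T, -, rfl⟩ | rfl | ⟨T, -, rfl⟩
  exacts [fun x hx => hx.1, fun x hx => hx, fun x hx => hx.1]

theorem zero_mem (hD : IsAdmissibleDomain D) : (0 : ℝ) ∈ D := by
  rcases hD with ⟨T, h, rfl⟩ | rfl | ⟨T, h, rfl⟩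
  exacts [⟨le_rfl, h⟩, le_refl (0 : ℝ), ⟨le_rfl, h.le⟩]

theorem mem_of_le (hD : IsAdmissibleDomain D) : ∀ x ∈ D, ∀ z, 0 ≤ z → z ≤ x → z ∈ D := by
  rcases hD with ⟨T, -, rfl⟩ | rfl | ⟨T, -, rfl⟩
  exacts [fun x hx z h0 hz => ⟨h0, hz.trans_lt hx.2⟩, fun x hx z h0 hz => h0,
    fun x hx z h0 hz => ⟨h0, hz.trans hx.2⟩]

/-- Anchored kernels only see intervals `[0, x)` with `x ∈ D`. For closed `D` these miss the right
end point, which is a null set. -/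
theorem exists_exhaustion (hD : IsAdmissibleDomain D) : ∃ x : ℕ → ℝ, Monotone x ∧ (∀ n, x n ∈ D) ∧
    ∀ᵐ t ∂(volume.restrict D), ∃ n, t ∈ Ico 0 (x n) := by
  have hm := hD.measurableSet
  rcases hD with ⟨T, h, rfl⟩ | rfl | ⟨T, h, rfl⟩
  · obtain ⟨x, hx, hxT, hlim⟩ := exists_seq_strictMono_tendsto' h
    refine ⟨x, hx.monotone, fun n => ⟨(hxT n).1.le, (hxT n).2⟩, ?_⟩
    refine (ae_restrict_iff' hm).2 (ae_of_all _ fun t ht => ?_)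
    obtain ⟨n, hn⟩ := (hlim.eventually (lt_mem_nhds ht.2)).exists
    exact ⟨n, ht.1, hn⟩
  · refine ⟨fun n => n, Nat.mono_cast, fun n => Nat.cast_nonneg (α := ℝ) n, ?_⟩
    refine (ae_restrict_iff' hm).2 (ae_of_all _ fun t ht => ?_)
    obtain ⟨n, hn⟩ := exists_nat_gt t
    exact ⟨n, ht, hn⟩
  · refine ⟨fun _ => T, monotone_const, fun _ => ⟨h.le, le_rfl⟩, ?_⟩
    refine (ae_restrict_iff' hm).2 ?_
    have : ∀ᵐ t : ℝ, t ≠ T := by simp [ae_iff]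
    filter_upwards [this] with t ht htD
    exact ⟨0, htD.1, lt_of_le_of_ne htD.2 ht⟩

end IsAdmissibleDomain

/-! ### From Lebesgue measure on `D` to the measure `ψ(t) dt` -/

/-- The probability measure `ψ(t) dt` on `D`. -/
noncomputable def densityMeasure (D : Set ℝ) (ψ : ℝ → ℝ) : Measure ℝ :=
  (volume.restrict D).withDensity fun t => ENNReal.ofReal (ψ t)

/-- `ρ` is a measurable and everywhere positive version of `ψ` on `D`. -/
structure IsRegularVersion (D : Set ℝ) (ψ : ℝ → ℝ) (ρ : ℝ → ℝ≥0) : Prop where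
  measurable : Measurable ρ
  pos : ∀ t, 0 < ρ t
  ae_eq : ∀ᵐ t ∂(volume.restrict D), ψ t = ρ t

theorem IsPositiveDensity.exists_isRegularVersion {D : Set ℝ} {ψ : ℝ → ℝ}
    (hψ : IsPositiveDensity D ψ) : ∃ ρ, IsRegularVersion D ψ ρ := by
  obtain ⟨φ, hφm, hφ⟩ := hψ.integrable.1
  have hm : MeasurableSet {t | 0 < φ t} := hφm.measurable measurableSet_Ioi
  -- On `D` the default value `1` is used only on a null set; it makes division by `ρ` legitimate
  -- everywhere.
  refine ⟨fun t => if 0 < φ t then (φ t).toNNReal else 1,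
    Measurable.ite hm hφm.measurable.real_toNNReal measurable_const, fun t => ?_, ?_⟩
  · split_ifs with h
    · exact Real.toNNReal_pos.2 h
    · exact one_pos
  · filter_upwards [hφ, hψ.pos_ae] with t ht hpos
    rw [ht] at hpos
    simp [hpos, ht, hpos.le]

/-- This is `1/p + 1/r = 1` multiplied by `r`. It includes `p = ∞`, `r = 1`, where `1 / p.toReal` is
`0` by convention. -/
theorem neg_one_div_toReal_mul_toReal {p r : ℝ≥0∞} [p.HolderConjugate r] (hp : 1 ≤ p) (hr : r ≠ ∞) :
    -(1 / p.toReal) * r.toReal = 1 - r.toReal := by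
  have hr0 : r ≠ 0 := ENNReal.HolderConjugate.ne_zero r p
  have h1 := ENNReal.HolderConjugate.inv_add_inv_eq_one p r
  have h2 : p.toReal⁻¹ + r.toReal⁻¹ = 1 := by
    rw [← ENNReal.toReal_inv, ← ENNReal.toReal_inv, ← ENNReal.toReal_add, h1, ENNReal.toReal_one]
    · exact ENNReal.inv_ne_top.2 (zero_lt_one.trans_le hp).ne'
    · exact ENNReal.inv_ne_top.2 hr0
  have hrp : r.toReal ≠ 0 := (ENNReal.toReal_pos hr0 hr).ne'
  have h3 : 1 / p.toReal = 1 - r.toReal⁻¹ := by rw [one_div]; linarith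
  rw [h3]; field_simp; ring

theorem mul_norm_div_rpow {a h s e : ℝ} (ha : 0 < a) (he : e * s = 1 - s) :
    ‖h * a ^ e‖ ^ s = a * ‖h / a‖ ^ s := by
  rw [norm_mul, norm_div, Real.mul_rpow (norm_nonneg _) (norm_nonneg _),
    Real.norm_of_nonneg (Real.rpow_nonneg ha.le _), ← Real.rpow_mul ha.le, he,
    Real.norm_of_nonneg ha.le, Real.div_rpow (norm_nonneg _) ha.le, Real.rpow_sub ha, Real.rpow_one]
  ring

section Density

variable {D : Set ℝ} {ψ : ℝ → ℝ} {ρ : ℝ → ℝ≥0}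

theorem IsPositiveDensity.isProbabilityMeasure (hψ : IsPositiveDensity D ψ) :
    IsProbabilityMeasure (densityMeasure D ψ) := by
  refine ⟨?_⟩
  have hnn : 0 ≤ᵐ[volume.restrict D] ψ := by
    filter_upwards [hψ.pos_ae] with t ht using ht.le
  rw [densityMeasure, withDensity_apply _ MeasurableSet.univ, Measure.restrict_univ,
    ← ofReal_integral_eq_lintegral_ofReal hψ.integrable hnn, hψ.integral_eq_one, ENNReal.ofReal_one]

namespace IsRegularVersion

theorem densityMeasure_eq (hρ : IsRegularVersion D ψ ρ) :
    densityMeasure D ψ = (volume.restrict D).withDensity fun t => ρ t := by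
  refine withDensity_congr_ae ?_
  filter_upwards [hρ.ae_eq] with t ht
  rw [ht, ENNReal.ofReal_coe_nnreal]

theorem absolutelyContinuous (hρ : IsRegularVersion D ψ ρ) :
    volume.restrict D ≪ densityMeasure D ψ := by
  rw [hρ.densityMeasure_eq]
  exact withDensity_absolutelyContinuous' hρ.measurable.coe_nnreal_ennreal.aemeasurable
    (ae_of_all _ fun t => by simpa using (hρ.pos t).ne')

/-- For finite `r`, `|h ψ^(-1/p)|^r = ψ |h/ψ|^r`, so the two `L_r` norms coincide. For `r = ∞` one
has `p = 1`, the functions agree, and absolute continuity suffices. -/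
theorem memLp_div (hρ : IsRegularVersion D ψ ρ) {p r : ℝ≥0∞} [p.HolderConjugate r] (hp : 1 ≤ p)
    {h : ℝ → ℝ} (hm : AEStronglyMeasurable h (volume.restrict D))
    (hh : MemLp (fun t => h t * ψ t ^ (-(1 / p.toReal))) r (volume.restrict D)) :
    MemLp (fun t => h t / ρ t) r (densityMeasure D ψ) := by
  have hac : densityMeasure D ψ ≪ volume.restrict D := withDensity_absolutelyContinuous _ _
  have hm' : AEStronglyMeasurable (fun t => h t / ρ t) (densityMeasure D ψ) :=
    ((hm.mono_ac hac).aemeasurable.div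
      hρ.measurable.coe_nnreal_real.aemeasurable).aestronglyMeasurable
  have hh' : MemLp (fun t => h t * (ρ t : ℝ) ^ (-(1 / p.toReal))) r (volume.restrict D) := by
    refine (memLp_congr_ae ?_).1 hh
    filter_upwards [hρ.ae_eq] with t ht
    rw [ht]
  have hr0 : r ≠ 0 := ENNReal.HolderConjugate.ne_zero r p
  rcases eq_or_ne r ∞ with hr | hr
  · have hp1 : p = 1 := (ENNReal.HolderConjugate.eq_top_iff_eq_one r p).1 hr
    have hfun : (fun t => h t / ρ t) = fun t => h t * (ρ t : ℝ) ^ (-(1 / p.toReal)) := by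
      ext t
      rw [hp1, ENNReal.toReal_one, div_one, Real.rpow_neg_one, div_eq_mul_inv]
    rw [← hfun, hr] at hh'
    rw [hr]
    refine ⟨hm', lt_of_le_of_lt ?_ hh'.2⟩
    rw [eLpNorm_exponent_top, eLpNorm_exponent_top]
    exact essSup_mono_measure hac
  · have hi := (integrable_norm_rpow_iff hh'.1 hr0 hr).2 hh'
    refine (integrable_norm_rpow_iff hm' hr0 hr).1 ?_
    rw [hρ.densityMeasure_eq]
    refine (integrable_withDensity_iff_integrable_smul hρ.measurable).2 (hi.congr ?_)
    exact ae_of_all _ fun t =>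
      mul_norm_div_rpow (hρ.pos t) (neg_one_div_toReal_mul_toReal hp hr)

/-- The product density cancels the denominators of the normalized kernels, and the coordinates
outside `u` integrate to one. -/
theorem superposition_eq (hρ : IsRegularVersion D ψ ρ) [IsProbabilityMeasure (densityMeasure D ψ)]
    {d : ℕ} (K : ℝ → ℝ → ℝ) (u : Finset (Fin d)) {g : (u → ℝ) → ℝ} (x : Fin d → D) {r : ℝ≥0∞}
    (hK : ∀ x : D, MemLp (fun t => K x t / ρ t) r (densityMeasure D ψ))
    (hg : AEStronglyMeasurable g (Measure.pi fun _ => densityMeasure D ψ)) :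
    superposition D K u g x = ∫ t, g (u.restrict t) * ∏ j ∈ u, (K (x j) (t j) / ρ (t j))
      ∂(Measure.pi fun _ => densityMeasure D ψ) := by
  have hm : AEStronglyMeasurable (fun t : u → ℝ => g t * ∏ j : u, (K (x j) (t j) / ρ (t j)))
      (Measure.pi fun _ : u => densityMeasure D ψ) :=
    hg.mul (Finset.aestronglyMeasurable_fun_prod _ fun j _ =>
      (hK (x j)).1.comp_measurePreserving (measurePreserving_eval (fun _ => densityMeasure D ψ) j))
  have hr := measurePreserving_finsetRestrict (densityMeasure D ψ) u
  have h1 : ∫ t, g (u.restrict t) * ∏ j ∈ u, (K (x j) (t j) / ρ (t j))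
      ∂(Measure.pi fun _ => densityMeasure D ψ)
      = ∫ t : u → ℝ, g t * ∏ j : u, (K (x j) (t j) / ρ (t j))
        ∂(Measure.pi fun _ => densityMeasure D ψ) := by
    rw [← hr.map_eq, integral_map hr.measurable.aemeasurable (by rw [hr.map_eq]; exact hm)]
    congr 1; ext t; congr 1
    exact (Finset.prod_coe_sort u fun j => K (x j) (t j) / ρ (t j)).symm
  have hfin : IsFiniteMeasure ((volume.restrict D).withDensity fun t => (ρ t : ℝ≥0∞)) := by
    rw [← hρ.densityMeasure_eq]; infer_instance
  have hP : Measurable fun t : u → ℝ => ∏ i, ρ (t i) :=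
    Finset.measurable_fun_prod _ fun i _ => hρ.measurable.comp (measurable_pi_apply i)
  rw [h1, hρ.densityMeasure_eq, pi_withDensity hρ.measurable, superposition,
    integral_withDensity_eq_integral_smul hP]
  congr 1; ext t
  have : (∏ i : u, (ρ (t i) : ℝ)) ≠ 0 :=
    Finset.prod_ne_zero_iff.2 fun i _ => NNReal.coe_ne_zero.2 (hρ.pos _).ne'
  rw [NNReal.smul_def, NNReal.coe_prod, smul_eq_mul, Finset.prod_div_distrib]
  field_simp

end IsRegularVersion

/-- The kernel `K` divided by the density, as a kernel with respect to the measure `ψ(t) dt`. -/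
noncomputable def normalizedKernel (D : Set ℝ) (ρ : ℝ → ℝ≥0) (K : ℝ → ℝ → ℝ) (x : D) (t : ℝ) : ℝ :=
  K x t / ρ t

/-- The normalized kernel has sections in `L_r`, and the components of a function are unique. -/
structure IsUniqueKernel (D : Set ℝ) (ψ : ℝ → ℝ) (ρ : ℝ → ℝ≥0) (p r : ℝ≥0∞) (K : ℝ → ℝ → ℝ) :
    Prop where
  memLp : ∀ x, MemLp (normalizedKernel D ρ K x) r (densityMeasure D ψ)
  unique : ∀ {d : ℕ} {G : Finset (Fin d) → (Fin d → ℝ) → ℝ},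
    IsComponentFamily (densityMeasure D ψ) p G →
    superpositionSum (densityMeasure D ψ) (fun _ => normalizedKernel D ρ K) G = 0 →
    ∀ u, G u =ᵐ[Measure.pi fun _ => densityMeasure D ψ] 0

/-! ### Weighted spaces and norms in terms of component families -/

section Translation

variable {p r : ℝ≥0∞} {K : ℝ → ℝ → ℝ} {d : ℕ} {γ : Finset (Fin d) → ℝ} {f : (Fin d → D) → ℝ}

theorem IsDecomposition.isComponentFamily [IsProbabilityMeasure (densityMeasure D ψ)]
    {g : (u : Finset (Fin d)) → (u → ℝ) → ℝ} (hg : IsDecomposition D ψ K p γ f g) :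
    IsComponentFamily (densityMeasure D ψ) p fun u t => g u (u.restrict t) where
  memLp u := (hg.memLp u).comp_measurePreserving (measurePreserving_finsetRestrict _ u)
  dependsOn u s t hst := by
    exact congrArg (g u) (funext fun i => hst i.1 i.2)

theorem IsDecomposition.eq_superpositionSum [IsProbabilityMeasure (densityMeasure D ψ)]
    (hρ : IsRegularVersion D ψ ρ)
    (hK : ∀ x, MemLp (normalizedKernel D ρ K x) r (densityMeasure D ψ))
    {g : (u : Finset (Fin d)) → (u → ℝ) → ℝ} (hg : IsDecomposition D ψ K p γ f g) :
    f = superpositionSum (densityMeasure D ψ) (fun _ => normalizedKernel D ρ K)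
      fun u t => g u (u.restrict t) := by
  ext x
  rw [hg.eq_sum x]
  exact Finset.sum_congr rfl fun u _ => hρ.superposition_eq K u x hK (hg.memLp u).1

theorem exists_isDecomposition [IsProbabilityMeasure (densityMeasure D ψ)]
    (hρ : IsRegularVersion D ψ ρ)
    (hK : ∀ x, MemLp (normalizedKernel D ρ K x) r (densityMeasure D ψ))
    (hγ : ∀ u, 0 < γ u) {G : Finset (Fin d) → (Fin d → ℝ) → ℝ}
    (hG : IsComponentFamily (densityMeasure D ψ) p G)
    (hf : f = superpositionSum (densityMeasure D ψ) (fun _ => normalizedKernel D ρ K) G) :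
    ∃ g, IsDecomposition D ψ K p γ f g ∧ G = fun u t => g u (u.restrict t) := by
  choose g hg hgG using fun u => exists_memLp_comp_restrict (hG.memLp u) (hG.dependsOn u)
  refine ⟨g, ⟨hg, fun u hu => absurd hu (hγ u).ne', fun x => ?_⟩, by ext u t; exact hgG u t⟩
  rw [hf]
  refine Finset.sum_congr rfl fun u _ => ?_
  rw [hρ.superposition_eq K u x hK (hg u).1]
  simp only [hgG, normalizedKernel]

theorem mem_weightedSpace_iff [IsProbabilityMeasure (densityMeasure D ψ)]
    (hρ : IsRegularVersion D ψ ρ)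
    (hK : ∀ x, MemLp (normalizedKernel D ρ K x) r (densityMeasure D ψ)) (hγ : ∀ u, 0 < γ u) :
    f ∈ weightedSpace D ψ K p γ ↔ ∃ G, IsComponentFamily (densityMeasure D ψ) p G ∧
      f = superpositionSum (densityMeasure D ψ) (fun _ => normalizedKernel D ρ K) G := by
  constructor
  · rintro ⟨g, hg⟩
    exact ⟨_, hg.isComponentFamily, hg.eq_superpositionSum hρ hK⟩
  · rintro ⟨G, hG, hf⟩
    obtain ⟨g, hg, -⟩ := exists_isDecomposition hρ hK hγ hG hf
    exact ⟨g, hg⟩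

theorem superpositionSum_sub {X : Type*} {ν : Measure ℝ} [IsProbabilityMeasure ν]
    [p.HolderConjugate r] {k : X → ℝ → ℝ} (hk : ∀ x, MemLp (k x) r ν)
    {G H : Finset (Fin d) → (Fin d → ℝ) → ℝ} (hG : IsComponentFamily ν p G)
    (hH : IsComponentFamily ν p H) :
    superpositionSum ν (fun _ => k) (fun u t => G u t - H u t)
      = superpositionSum ν (fun _ => k) G - superpositionSum ν (fun _ => k) H := by
  ext x
  simp only [superpositionSum, Pi.sub_apply]
  rw [← Finset.sum_sub_distrib]
  refine Finset.sum_congr rfl fun u _ => ?_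
  rw [← integral_sub (integrable_mul_prod_kernel (hG.memLp u) fun i _ => hk (x i))
    (integrable_mul_prod_kernel (hH.memLp u) fun i _ => hk (x i))]
  congr 1; ext t; ring

/-- The difference of two component families of `f` has superposition zero, hence vanishes almost
everywhere. So the infimum defining the norm runs over a single value. -/
theorem IsUniqueKernel.weightedNorm_eq [IsProbabilityMeasure (densityMeasure D ψ)]
    [p.HolderConjugate r] (hρ : IsRegularVersion D ψ ρ) (hK : IsUniqueKernel D ψ ρ p r K)
    (hγ : ∀ u, 0 < γ u) {G : Finset (Fin d) → (Fin d → ℝ) → ℝ}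
    (hG : IsComponentFamily (densityMeasure D ψ) p G)
    (hf : f = superpositionSum (densityMeasure D ψ) (fun _ => normalizedKernel D ρ K) G)
    (q : ℝ≥0∞) :
    weightedNorm D ψ K p q γ f = componentNorm (densityMeasure D ψ) p q γ G := by
  have key : ∀ g, IsDecomposition D ψ K p γ f g →
      (lqNorm q fun u => eLpNorm (g u) p (psiMeasure D ψ u) / ENNReal.ofReal (γ u))
        = componentNorm (densityMeasure D ψ) p q γ G := by
    intro g hg
    have hz := hK.unique (G := fun u t => g u (u.restrict t) - G u t)
      ⟨fun u => (hg.isComponentFamily.memLp u).sub (hG.memLp u), fun u s t hst => by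
        simp only [hG.dependsOn u hst]
        congr 1
        exact hg.isComponentFamily.dependsOn u hst⟩
      (by rw [superpositionSum_sub hK.memLp hg.isComponentFamily hG, ← hf,
            ← hg.eq_superpositionSum hρ hK.memLp, sub_self])
    unfold componentNorm
    congr 1; ext u; congr 1
    rw [← eLpNorm_congr_ae (f := fun t => g u (u.restrict t)) (g := G u) (by
      filter_upwards [hz u] with t ht using sub_eq_zero.1 ht)]
    exact (eLpNorm_comp_measurePreserving (hg.memLp u).1
      (measurePreserving_finsetRestrict (densityMeasure D ψ) u)).symm
  obtain ⟨g, hg, -⟩ := exists_isDecomposition hρ hK.memLp hγ hG hf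
  unfold weightedNorm
  refine le_antisymm ((iInf₂_le g hg).trans (key g hg).le) (le_iInf₂ fun g hg => (key g hg).ge)

end Translation

end Density

/-! ### Integrability of the kernels and uniqueness of anchored components -/

section KernelProperties

variable {D : Set ℝ} {ψ : ℝ → ℝ} {ρ : ℝ → ℝ≥0} {p r : ℝ≥0∞}

/-- Needed because monotonicity gives measurability of the tail. -/
theorem IsPositiveDensity.antitone_tail (hD : MeasurableSet D) (hψ : IsPositiveDensity D ψ) :
    Antitone (tail D ψ) := by
  intro s t hst
  refine setIntegral_mono_set (hψ.integrable.mono_set inter_subset_left) ?_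
    (Filter.Eventually.of_forall (inter_subset_inter_right D (Ioi_subset_Ioi hst)))
  exact (ae_restrict_iff' (hD.inter measurableSet_Ioi)).2 (ae_of_all _ fun t ht => hψ.nonneg t ht.1)

theorem IsPositiveDensity.tail_nonneg (hD : MeasurableSet D) (hψ : IsPositiveDensity D ψ) (t : ℝ) :
    0 ≤ tail D ψ t :=
  setIntegral_nonneg (hD.inter measurableSet_Ioi) fun t ht => hψ.nonneg t ht.1

theorem measurable_anchoredKernel (x : ℝ) : Measurable (anchoredKernel x) :=
  measurable_const.indicator measurableSet_Ico

theorem memLp_normalizedKernel_anchored [p.HolderConjugate r] (hD : IsAdmissibleDomain D)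
    (hρ : IsRegularVersion D ψ ρ) (hp : 1 ≤ p) (hI : IntegrabilityCondition D ψ p) (x : D) :
    MemLp (normalizedKernel D ρ anchoredKernel x) r (densityMeasure D ψ) := by
  refine hρ.memLp_div hp (measurable_anchoredKernel x).aestronglyMeasurable ?_
  have hsub : Ico 0 (x : ℝ) ⊆ D := fun t ht => hD.mem_of_le x x.2 t ht.1 ht.2.le
  have hres : (volume.restrict D).restrict (Ico 0 (x : ℝ)) = volume.restrict (Ico 0 (x : ℝ)) := by
    rw [Measure.restrict_restrict measurableSet_Ico, inter_eq_self_of_subset_left hsub]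
  have hfun : (fun t => anchoredKernel x t * ψ t ^ (-(1 / p.toReal)))
      = (Ico 0 (x : ℝ)).indicator fun t => ψ t ^ (-(1 / p.toReal)) := by
    ext t
    by_cases ht : t ∈ Ico 0 (x : ℝ) <;> simp [anchoredKernel, ht]
  rw [hfun, memLp_indicator_iff_restrict measurableSet_Ico, hres]
  rcases hI with ⟨rfl, -⟩ | ⟨-, hloc, -⟩
  -- For `p = ∞` the exponent of `ψ` is `0`, and a constant on a bounded interval is in every `L_r`.
  · simp only [ENNReal.toReal_top, div_zero, neg_zero, Real.rpow_zero]
    exact memLp_const 1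
  · rw [← ENNReal.HolderConjugate.conjExponent_eq (p := p) (q := r)]
    exact hloc x x.2

/-- The tail divided by the density. -/
noncomputable def tailRatio (D : Set ℝ) (ψ : ℝ → ℝ) (ρ : ℝ → ℝ≥0) (t : ℝ) : ℝ := tail D ψ t / ρ t

theorem memLp_tailRatio [p.HolderConjugate r] (hD : IsAdmissibleDomain D)
    (hψ : IsPositiveDensity D ψ) (hρ : IsRegularVersion D ψ ρ) (hp : 1 ≤ p)
    (hI : IntegrabilityCondition D ψ p) :
    MemLp (tailRatio D ψ ρ) r (densityMeasure D ψ) := by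
  refine hρ.memLp_div hp
    (hψ.antitone_tail hD.measurableSet).measurable.aestronglyMeasurable ?_
  rcases hI with ⟨rfl, h⟩ | ⟨-, -, h⟩
  · have hr : r = 1 := (ENNReal.HolderConjugate.eq_top_iff_eq_one ∞ r).1 rfl
    simp only [ENNReal.toReal_top, div_zero, neg_zero, Real.rpow_zero, mul_one, hr]
    exact memLp_one_iff_integrable.2 h
  · rwa [← ENNReal.HolderConjugate.conjExponent_eq (p := p) (q := r)]

theorem normalizedKernel_anova (x : D) (t : ℝ) : normalizedKernel D ρ (anovaKernel D ψ) x t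
    = normalizedKernel D ρ anchoredKernel x t + -1 * tailRatio D ψ ρ t := by
  simp only [normalizedKernel, anovaKernel, tailRatio]
  ring

/-- The anchored kernel vanishes at `x = 0`. Setting the coordinates outside `u` to `0` removes
every `v` not contained in `u`, and induction removes the proper subsets of `u`. -/
theorem integral_anchored_eq_zero {ν : Measure ℝ} (h0 : (0 : ℝ) ∈ D) {d : ℕ}
    {G : Finset (Fin d) → (Fin d → ℝ) → ℝ}
    (hG : superpositionSum ν (fun _ => normalizedKernel D ρ anchoredKernel) G = 0)
    (u : Finset (Fin d)) (x : Fin d → D) :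
    ∫ t, G u t * ∏ j ∈ u, normalizedKernel D ρ anchoredKernel (x j) (t j)
      ∂(Measure.pi fun _ => ν) = 0 := by
  induction u using Finset.strongInduction generalizing x with
  | H u ih =>
    set y : Fin d → D := fun j => if j ∈ u then x j else ⟨0, h0⟩ with hy
    have hsum := congrFun hG y
    simp only [superpositionSum, Pi.zero_apply] at hsum
    rw [Finset.sum_eq_single u] at hsum
    · rw [← hsum]
      congr 1; ext t; congr 1
      refine Finset.prod_congr rfl fun j hj => ?_
      simp [hy, hj]
    · intro v _ hvu
      by_cases hsub : v ⊆ u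
      · exact ih v (Finset.ssubset_iff_subset_ne.2 ⟨hsub, hvu⟩) y
      · obtain ⟨j, hjv, hju⟩ := Finset.not_subset.1 hsub
        have : ∀ t : Fin d → ℝ,
            ∏ j ∈ v, normalizedKernel D ρ anchoredKernel (y j) (t j) = 0 := fun t =>
          Finset.prod_eq_zero hjv (by simp [hy, hju, normalizedKernel, anchoredKernel])
        simp [this]
    · simp

theorem prod_normalizedKernel_anchored {ι : Type*} [Fintype ι] (y : ι → D) (t : ι → ℝ) :
    ∏ j, normalizedKernel D ρ anchoredKernel (y j) (t j)
      = (univ.pi fun j => Ico 0 (y j : ℝ)).indicator (fun t => ∏ j, (ρ (t j) : ℝ)⁻¹) t := by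
  by_cases ht : t ∈ univ.pi fun j => Ico 0 (y j : ℝ)
  · rw [indicator_of_mem ht]
    refine Finset.prod_congr rfl fun j _ => ?_
    have := ht j (mem_univ j)
    simp only [normalizedKernel, anchoredKernel, indicator_of_mem this, one_div]
  · rw [indicator_of_notMem ht]
    simp only [mem_pi, mem_univ, true_implies, not_forall] at ht
    obtain ⟨j, hj⟩ := ht
    exact Finset.prod_eq_zero (Finset.mem_univ j)
      (by simp only [normalizedKernel, anchoredKernel, indicator_of_notMem hj, zero_div])

/-- Each single superposition vanishes, which says that `g_u ∏ 1/ρ(t_j)` has zero integral over all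
anchored boxes. Hence this product is zero almost everywhere, and so is `g_u`, as `ρ` is finite and
positive. -/
theorem isUniqueKernel_anchored [p.HolderConjugate r] (hD : IsAdmissibleDomain D)
    (hψ : IsPositiveDensity D ψ) (hρ : IsRegularVersion D ψ ρ)
    (hk : ∀ x, MemLp (normalizedKernel D ρ anchoredKernel x) r (densityMeasure D ψ)) :
    IsUniqueKernel D ψ ρ p r anchoredKernel where
  memLp := hk
  unique {d G} hG hz u := by
    have := hψ.isProbabilityMeasure
    set ν := densityMeasure D ψ
    obtain ⟨g, hg, hGg⟩ := exists_memLp_comp_restrict (hG.memLp u) (hG.dependsOn u)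
    have hr := measurePreserving_finsetRestrict ν u
    have hprod : ∀ y : u → D, MemLp (fun t : u → ℝ =>
        ∏ j, normalizedKernel D ρ anchoredKernel (y j) (t j)) r (Measure.pi fun _ => ν) := fun y =>
      MemLp.prod_coordinates (u := Finset.univ) fun j _ => hk (y j)
    have hint : ∀ y : u → D, Integrable (fun t : u → ℝ =>
        g t * ∏ j, normalizedKernel D ρ anchoredKernel (y j) (t j)) (Measure.pi fun _ => ν) :=
      fun y => hg.integrable_mul (hprod y)
    have hzero : ∀ y : u → D, ∫ t : u → ℝ,
        g t * ∏ j, normalizedKernel D ρ anchoredKernel (y j) (t j) ∂(Measure.pi fun _ => ν) = 0 := by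
      intro y
      have h1 := integral_anchored_eq_zero hD.zero_mem hz u
        fun j => if h : j ∈ u then y ⟨j, h⟩ else ⟨0, hD.zero_mem⟩
      rw [← h1]
      rw [← hr.map_eq, integral_map hr.measurable.aemeasurable
        (by rw [hr.map_eq]; exact (hint y).1)]
      congr 1; ext t
      rw [hGg t]
      congr 1
      rw [← Finset.prod_coe_sort u]
      refine Finset.prod_congr rfl fun j _ => ?_
      simp
    obtain ⟨x, hxm, hxD, hxae⟩ := hD.exists_exhaustion
    have hac : ν ≪ volume.restrict D := withDensity_absolutelyContinuous _ _
    set B : (u → ℝ) → Set (u → ℝ) := fun y => univ.pi fun j => Ico 0 (y j) with hB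
    have hBm : ∀ y, MeasurableSet (B y) := fun y => MeasurableSet.univ_pi fun _ => measurableSet_Ico
    have hFB : ∀ (y : u → D) t, (B fun j => y j).indicator (fun t => g t * ∏ j, (ρ (t j) : ℝ)⁻¹) t
        = g t * ∏ j, normalizedKernel D ρ anchoredKernel (y j) (t j) := by
      intro y t
      rw [prod_normalizedKernel_anchored, indicator_mul_right]
    have hF := ae_eq_zero_of_integral_boxes (m := Measure.pi fun _ : u => ν) hD.nonneg hD.mem_of_le
      (F := fun t => g t * ∏ j, (ρ (t j) : ℝ)⁻¹) (x := x) hxD ?_ (fun n => ?_) fun y hy => ?_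
    · have : g =ᵐ[Measure.pi fun _ : u => ν] 0 := by
        filter_upwards [hF] with t ht
        have hne : ∏ j, (ρ (t j) : ℝ)⁻¹ ≠ 0 := Finset.prod_ne_zero_iff.2 fun j _ =>
          inv_ne_zero (NNReal.coe_ne_zero.2 (hρ.pos _).ne')
        exact (mul_eq_zero.1 ht).resolve_right hne
      filter_upwards [hr.quasiMeasurePreserving.ae this] with t ht
      rw [hGg t]; exact ht
    · have h1 : ∀ᵐ t ∂(Measure.pi fun _ : u => ν), ∀ i, ∃ n, t i ∈ Ico 0 (x n) :=
        ae_all_iff.2 fun i => (measurePreserving_eval (fun _ : u => ν) i).quasiMeasurePreserving.ae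
          (hac.ae_le hxae)
      filter_upwards [h1] with t ht
      choose n hn using ht
      -- One index serves all coordinates because the exhaustion is monotone.
      refine ⟨Finset.univ.sup n, fun i _ => ⟨(hn i).1, (hn i).2.trans_le (hxm ?_)⟩⟩
      exact Finset.le_sup (Finset.mem_univ i)
    · rw [← integrable_indicator_iff (hBm fun _ => x n)]
      exact (hint fun _ => ⟨x n, hxD n⟩).congr
        (ae_of_all _ fun t => (hFB (fun _ => ⟨x n, hxD n⟩) t).symm)
    · rw [← integral_indicator (hBm y)]
      refine (integral_congr_ae (ae_of_all _ (hFB fun j => ⟨y j, hy j⟩))).trans (hzero _)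

end KernelProperties

/-! ### The embedding as a change of kernel: upper bound and symmetry -/

/-- The normalized kernels of `K₁` and `K₂` differ by `± w`, and both have unique components. -/
structure KernelSwitch (D : Set ℝ) (ψ : ℝ → ℝ) (ρ : ℝ → ℝ≥0) (p r : ℝ≥0∞) (w : ℝ → ℝ) (σ : ℝ)
    (K₁ K₂ : ℝ → ℝ → ℝ) : Prop where
  memLp : MemLp w r (densityMeasure D ψ)
  abs_eq : |σ| = 1
  eq_add : ∀ x t, normalizedKernel D ρ K₁ x t = normalizedKernel D ρ K₂ x t + σ * w t
  left : IsUniqueKernel D ψ ρ p r K₁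
  right : IsUniqueKernel D ψ ρ p r K₂

section

variable {D : Set ℝ} {ψ : ℝ → ℝ} {ρ : ℝ → ℝ≥0} {p r : ℝ≥0∞} {w : ℝ → ℝ} {σ : ℝ}
  {K₁ K₂ : ℝ → ℝ → ℝ}

theorem KernelSwitch.symm (h : KernelSwitch D ψ ρ p r w σ K₁ K₂) :
    KernelSwitch D ψ ρ p r w (-σ) K₂ K₁ where
  memLp := h.memLp
  abs_eq := by rw [abs_neg, h.abs_eq]
  eq_add x t := by rw [h.eq_add]; ring
  left := h.right
  right := h.left

theorem isUniqueKernel_anova [p.HolderConjugate r] (hp : 1 ≤ p) (hψ : IsPositiveDensity D ψ)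
    (hw : MemLp (tailRatio D ψ ρ) r (densityMeasure D ψ))
    (hK : IsUniqueKernel D ψ ρ p r anchoredKernel) :
    IsUniqueKernel D ψ ρ p r (anovaKernel D ψ) := by
  have := hψ.isProbabilityMeasure
  have hm : ∀ x, MemLp (normalizedKernel D ρ (anovaKernel D ψ) x) r (densityMeasure D ψ) := by
    intro x
    rw [funext (normalizedKernel_anova x)]
    exact (hK.memLp x).add (hw.const_mul (-1))
  refine ⟨hm, fun {d G} hG hz => ?_⟩
  -- Switching all coordinates to the anchored kernel is injective on components. The unit weights
  -- enter only the discarded norm bound.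
  obtain ⟨H, hH, h1, -, -, h2⟩ := exists_switch hp hw (σ := -1) (by norm_num) hK.memLp hm
    normalizedKernel_anova (γ := fun _ => 1) (fun _ => one_pos) hG Finset.univ
  exact h2 (hK.unique hH (by simpa [hz] using h1.symm))

namespace KernelSwitch

variable [p.HolderConjugate r] {γ : ℕ → ℝ} {d : ℕ}

theorem transfer [IsProbabilityMeasure (densityMeasure D ψ)]
    (h : KernelSwitch D ψ ρ p r w σ K₁ K₂) (hp : 1 ≤ p) (hγ : ∀ j, 0 < γ j)
    {G : Finset (Fin d) → (Fin d → ℝ) → ℝ} (hG : IsComponentFamily (densityMeasure D ψ) p G) :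
    ∃ H, IsComponentFamily (densityMeasure D ψ) p H ∧
      superpositionSum (densityMeasure D ψ) (fun _ => normalizedKernel D ρ K₁) G
        = superpositionSum (densityMeasure D ψ) (fun _ => normalizedKernel D ρ K₂) H ∧
      superpositionSum (densityMeasure D ψ) (fun _ => normalizedKernel D ρ K₂) (alternate G)
        = superpositionSum (densityMeasure D ψ) (fun _ => normalizedKernel D ρ K₁) (alternate H) ∧
      ∀ q, 1 ≤ q → componentNorm (densityMeasure D ψ) p q (productWeights γ d) H
        ≤ (∏ i : Fin d, (1 + eLpNorm w r (densityMeasure D ψ) * ENNReal.ofReal (γ i)))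
          * componentNorm (densityMeasure D ψ) p q (productWeights γ d) G := by
  obtain ⟨H, hH, h1, h2, h3, -⟩ := exists_switch hp h.memLp h.abs_eq.le h.right.memLp h.left.memLp
    h.eq_add hγ hG Finset.univ
  exact ⟨H, hH, by simpa using h1, by simpa using h2, h3⟩

theorem weightedSpace_subset (h : KernelSwitch D ψ ρ p r w σ K₁ K₂) (hψ : IsPositiveDensity D ψ)
    (hρ : IsRegularVersion D ψ ρ) (hp : 1 ≤ p) (hγ : ∀ j, 0 < γ j) :
    weightedSpace D ψ K₁ p (productWeights γ d) ⊆ weightedSpace D ψ K₂ p (productWeights γ d) := by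
  have := hψ.isProbabilityMeasure
  have hpos : ∀ u, 0 < productWeights γ d u := fun u => Finset.prod_pos fun i _ => hγ i
  intro f hf
  obtain ⟨G, hG, rfl⟩ := (mem_weightedSpace_iff hρ h.left.memLp hpos).1 hf
  obtain ⟨H, hH, h1, -⟩ := h.transfer hp hγ hG
  exact (mem_weightedSpace_iff hρ h.right.memLp hpos).2 ⟨H, hH, h1⟩

theorem idNorm_le (h : KernelSwitch D ψ ρ p r w σ K₁ K₂) (hψ : IsPositiveDensity D ψ)
    (hρ : IsRegularVersion D ψ ρ) (hp : 1 ≤ p) {q : ℝ≥0∞} (hq : 1 ≤ q) (hγ : ∀ j, 0 < γ j) :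
    idNorm D ψ K₁ K₂ p q (productWeights γ d)
      ≤ ∏ i : Fin d, (1 + eLpNorm w r (densityMeasure D ψ) * ENNReal.ofReal (γ i)) := by
  have := hψ.isProbabilityMeasure
  have hpos : ∀ u, 0 < productWeights γ d u := fun u => Finset.prod_pos fun i _ => hγ i
  refine iSup_le fun f => iSup₂_le fun hf hf1 => ?_
  obtain ⟨G, hG, rfl⟩ := (mem_weightedSpace_iff hρ h.left.memLp hpos).1 hf
  obtain ⟨H, hH, h1, -, h3⟩ := h.transfer hp hγ hG
  rw [h.left.weightedNorm_eq hρ hpos hG rfl] at hf1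
  rw [h.right.weightedNorm_eq hρ hpos hH h1]
  exact (h3 q hq).trans (mul_le_of_le_one_right zero_le hf1)

/-- If `f` has `K₁`-components `G` and `K₂`-components `H`, then the function with `K₂`-components
`alternate G` has `K₁`-components `alternate H`. Signs do not affect norms, so the reverse embedding
attains the same ratio. -/
theorem idNorm_le_symm (h : KernelSwitch D ψ ρ p r w σ K₁ K₂) (hψ : IsPositiveDensity D ψ)
    (hρ : IsRegularVersion D ψ ρ) (hp : 1 ≤ p) (q : ℝ≥0∞) (hγ : ∀ j, 0 < γ j) :
    idNorm D ψ K₁ K₂ p q (productWeights γ d) ≤ idNorm D ψ K₂ K₁ p q (productWeights γ d) := by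
  have := hψ.isProbabilityMeasure
  have hpos : ∀ u, 0 < productWeights γ d u := fun u => Finset.prod_pos fun i _ => hγ i
  refine iSup_le fun f => iSup₂_le fun hf hf1 => ?_
  obtain ⟨G, hG, rfl⟩ := (mem_weightedSpace_iff hρ h.left.memLp hpos).1 hf
  obtain ⟨H, hH, h1, h2, -⟩ := h.transfer hp hγ hG
  rw [h.left.weightedNorm_eq hρ hpos hG rfl] at hf1
  rw [h.right.weightedNorm_eq hρ hpos hH h1, ← componentNorm_alternate,
    ← h.left.weightedNorm_eq hρ hpos hH.alternate h2]
  refine le_iSup_of_le _ (le_iSup₂_of_le ?_ ?_ le_rfl)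
  · exact (mem_weightedSpace_iff hρ h.right.memLp hpos).2 ⟨_, hG.alternate, rfl⟩
  · rwa [h.right.weightedNorm_eq hρ hpos hG.alternate rfl, componentNorm_alternate]

/-- The operator norm is a supremum over the unit ball, so `G` is rescaled by the inverse of its
norm. -/
theorem componentNorm_le (h : KernelSwitch D ψ ρ p r w σ K₁ K₂) (hψ : IsPositiveDensity D ψ)
    (hρ : IsRegularVersion D ψ ρ) {q : ℝ≥0∞} (hq : 1 ≤ q) (hγ : ∀ j, 0 < γ j)
    {G H : Finset (Fin d) → (Fin d → ℝ) → ℝ} (hG : IsComponentFamily (densityMeasure D ψ) p G)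
    (hH : IsComponentFamily (densityMeasure D ψ) p H)
    (hGH : superpositionSum (densityMeasure D ψ) (fun _ => normalizedKernel D ρ K₁) G
        = superpositionSum (densityMeasure D ψ) (fun _ => normalizedKernel D ρ K₂) H)
    (hG0 : componentNorm (densityMeasure D ψ) p q (productWeights γ d) G ≠ 0)
    (hGt : componentNorm (densityMeasure D ψ) p q (productWeights γ d) G ≠ ∞) :
    componentNorm (densityMeasure D ψ) p q (productWeights γ d) H
      ≤ idNorm D ψ K₁ K₂ p q (productWeights γ d)
        * componentNorm (densityMeasure D ψ) p q (productWeights γ d) G := by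
  have := hψ.isProbabilityMeasure
  have hpos : ∀ u, 0 < productWeights γ d u := fun u => Finset.prod_pos fun i _ => hγ i
  set N := componentNorm (densityMeasure D ψ) p q (productWeights γ d) G
  set c : ℝ := N.toReal⁻¹ with hc
  have hN : 0 < N.toReal := ENNReal.toReal_pos hG0 hGt
  have hce : ‖c‖ₑ = N⁻¹ := by
    rw [hc, Real.enorm_of_nonneg (by positivity), ENNReal.ofReal_inv_of_pos hN, ENNReal.ofReal_toReal hGt]
  have hfam : ∀ {F : Finset (Fin d) → (Fin d → ℝ) → ℝ}, IsComponentFamily (densityMeasure D ψ) p F →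
      IsComponentFamily (densityMeasure D ψ) p (fun u t => c * F u t) := fun {F} hF =>
    ⟨fun u => (hF.memLp u).const_mul c, fun u s t hst => by simp only [hF.dependsOn u hst]⟩
  have hsum : ∀ (k : D → ℝ → ℝ) (F : Finset (Fin d) → (Fin d → ℝ) → ℝ),
      superpositionSum (densityMeasure D ψ) (fun _ => k) (fun u t => c * F u t)
        = c • superpositionSum (densityMeasure D ψ) (fun _ => k) F := by
    intro k F; ext x
    simp only [superpositionSum, Pi.smul_apply, smul_eq_mul, Finset.mul_sum, mul_assoc,
      integral_const_mul]
  have hnorm : ∀ F : Finset (Fin d) → (Fin d → ℝ) → ℝ,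
      componentNorm (densityMeasure D ψ) p q (productWeights γ d) (fun u t => c * F u t)
        = N⁻¹ * componentNorm (densityMeasure D ψ) p q (productWeights γ d) F := by
    intro F
    unfold componentNorm
    rw [← lqNorm_const_mul hq]
    congr 1; ext u
    rw [← hce, ← mul_div_assoc, ← eLpNorm_const_smul]
    rfl
  have key : componentNorm (densityMeasure D ψ) p q (productWeights γ d) (fun u t => c * H u t)
      ≤ idNorm D ψ K₁ K₂ p q (productWeights γ d) := by
    have heq : superpositionSum (densityMeasure D ψ) (fun _ => normalizedKernel D ρ K₁)
          (fun u t => c * G u t)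
        = superpositionSum (densityMeasure D ψ) (fun _ => normalizedKernel D ρ K₂)
          (fun u t => c * H u t) := by rw [hsum, hsum, hGH]
    rw [← h.right.weightedNorm_eq hρ hpos (hfam hH) heq]
    refine le_iSup_of_le _ (le_iSup₂_of_le ?_ ?_ le_rfl)
    · exact (mem_weightedSpace_iff hρ h.left.memLp hpos).2 ⟨_, hfam hG, rfl⟩
    · rw [h.left.weightedNorm_eq hρ hpos (hfam hG) rfl, hnorm, ENNReal.inv_mul_cancel hG0 hGt]
  rw [hnorm] at key
  rw [← ENNReal.div_le_iff hG0 hGt, div_eq_mul_inv, mul_comm]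
  exact key

end KernelSwitch

end

/-! ### Lower bounds from product functions -/

/-- The components `∏_{j ∈ u} c_j g(t_j) ∏_{j ∉ u} e_j` of a product function. -/
noncomputable def productFamily {d : ℕ} (c e : Fin d → ℝ) (g : ℝ → ℝ) (u : Finset (Fin d))
    (t : Fin d → ℝ) : ℝ := ((∏ j ∈ u, c j) * ∏ j ∈ uᶜ, e j) * ∏ j ∈ u, g (t j)

section ProductFamily

variable {ν : Measure ℝ} [IsProbabilityMeasure ν] {p r : ℝ≥0∞} {d : ℕ} {c e : Fin d → ℝ} {g : ℝ → ℝ}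

theorem isComponentFamily_productFamily (hg : MemLp g p ν) :
    IsComponentFamily ν p (productFamily c e g) where
  memLp u := (MemLp.prod_coordinates (u := u) fun _ _ => hg).const_mul _
  dependsOn u s t hst := by
    simp only [productFamily]
    congr 1
    exact Finset.prod_congr rfl fun j hj => by rw [hst j hj]

/-- Fubini factorizes each summand, and the sum over `u` is the expansion of the product of
binomials. -/
theorem superpositionSum_productFamily {X : Type*} (k : X → ℝ → ℝ) (x : Fin d → X) :
    superpositionSum ν (fun _ => k) (productFamily c e g) x
      = ∏ j, (c j * ∫ t, g t * k (x j) t ∂ν + e j) := by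
  rw [Finset.prod_add, Finset.powerset_univ]
  refine Finset.sum_congr rfl fun u _ => ?_
  have h1 : ∀ t : Fin d → ℝ, productFamily c e g u t * ∏ j ∈ u, k (x j) (t j)
      = ((∏ j ∈ u, c j) * ∏ j ∈ uᶜ, e j) * ∏ j, if j ∈ u then g (t j) * k (x j) (t j) else 1 := by
    intro t
    rw [productFamily, mul_assoc, ← Finset.prod_mul_distrib]
    simp
  simp_rw [h1]
  rw [integral_const_mul, integral_fintype_prod_eq_prod (μ := fun _ => ν)
    (f := fun j s => if j ∈ u then g s * k (x j) s else 1)]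
  have h2 : ∀ j, ∫ s, (if j ∈ u then g s * k (x j) s else 1) ∂ν
      = if j ∈ u then ∫ s, g s * k (x j) s ∂ν else 1 := by
    intro j; split_ifs <;> simp
  simp_rw [h2]
  rw [Finset.prod_mul_distrib, ← Finset.compl_eq_univ_sdiff]
  simp only [Finset.prod_ite_mem, Finset.univ_inter]
  ring

omit [IsProbabilityMeasure ν] in
theorem componentNorm_productFamily
    (hg : ∀ u : Finset (Fin d), eLpNorm (fun t => ∏ j ∈ u, g (t j)) p (Measure.pi fun _ => ν) = 1)
    {γ : ℕ → ℝ} (hγ : ∀ j, 0 < γ j) {β : ℝ} (hβ : 0 ≤ β) {σ : ℝ} (hσ : |σ| = 1)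
    (he : ∀ j, 0 ≤ e j) (q : ℝ≥0∞) :
    componentNorm ν p q (productWeights γ d) (productFamily (fun j => σ * γ j * β) e g)
      = lqNorm q fun u => ENNReal.ofReal ((∏ _j ∈ u, β) * ∏ j ∈ uᶜ, e j) := by
  unfold componentNorm
  congr 1; ext u
  have hpos : 0 < productWeights γ d u := Finset.prod_pos fun i _ => hγ i
  have h1 : eLpNorm (productFamily (fun j => σ * γ j * β) e g u) p (Measure.pi fun _ => ν)
      = ‖(∏ j ∈ u, σ * γ j * β) * ∏ j ∈ uᶜ, e j‖ₑ := by
    have := eLpNorm_const_smul ((∏ j ∈ u, σ * γ j * β) * ∏ j ∈ uᶜ, e j)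
      (fun t : Fin d → ℝ => ∏ j ∈ u, g (t j)) p (Measure.pi fun _ => ν)
    rw [hg, mul_one] at this
    exact this
  have h2 : ‖(∏ j ∈ u, σ * γ j * β) * ∏ j ∈ uᶜ, e j‖
      = ((∏ _j ∈ u, β) * ∏ j ∈ uᶜ, e j) * productWeights γ d u := by
    rw [norm_mul, norm_prod, Real.norm_of_nonneg (Finset.prod_nonneg fun j _ => he j),
      productWeights]
    have : ∀ j : Fin d, ‖σ * γ j * β‖ = γ j * β := fun j => by
      rw [norm_mul, norm_mul, Real.norm_eq_abs, hσ, one_mul, Real.norm_of_nonneg (hγ j).le,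
        Real.norm_of_nonneg hβ]
    simp_rw [this]
    rw [Finset.prod_mul_distrib]
    ring
  rw [h1, ← ofReal_norm, h2, ENNReal.ofReal_mul' hpos.le, mul_div_assoc,
    ENNReal.div_self (by simpa using hpos) ENNReal.ofReal_ne_top, mul_one]

end ProductFamily

/-- With `c_j = σ γ_j β`, passing from `K₁` to `K₂` only changes the constant of each factor, from
`α` to `α + σ c_j ℓ`. As `σ² = 1`, the sign in `c_j` makes the increment `γ_j β ℓ` nonnegative, and
its factor `γ_j` cancels the weights in the norms. -/
theorem KernelSwitch.lqNorm_le {D : Set ℝ} {ψ : ℝ → ℝ} {ρ : ℝ → ℝ≥0} {p r : ℝ≥0∞} {w : ℝ → ℝ}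
    {σ : ℝ} {K₁ K₂ : ℝ → ℝ → ℝ} [p.HolderConjugate r] {γ : ℕ → ℝ} {d : ℕ}
    (h : KernelSwitch D ψ ρ p r w σ K₁ K₂) (hψ : IsPositiveDensity D ψ)
    (hρ : IsRegularVersion D ψ ρ) {q : ℝ≥0∞} (hq : 1 ≤ q) (hγ : ∀ j, 0 < γ j) {g : ℝ → ℝ}
    (hg : MemLp g p (densityMeasure D ψ))
    (hg1 : ∀ u : Finset (Fin d), eLpNorm (fun t => ∏ j ∈ u, g (t j)) p
      (Measure.pi fun _ => densityMeasure D ψ) = 1)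
    (hℓ : 0 ≤ ∫ t, g t * w t ∂(densityMeasure D ψ)) {α β : ℝ} (hα : 0 ≤ α) (hβ : 0 ≤ β)
    (h0 : lqNorm q (fun u : Finset (Fin d) =>
      ENNReal.ofReal ((∏ _j ∈ u, β) * ∏ _j ∈ uᶜ, α)) ≠ 0)
    (ht : lqNorm q (fun u : Finset (Fin d) =>
      ENNReal.ofReal ((∏ _j ∈ u, β) * ∏ _j ∈ uᶜ, α)) ≠ ∞) :
    lqNorm q (fun u : Finset (Fin d) => ENNReal.ofReal ((∏ _j ∈ u, β)
        * ∏ j ∈ uᶜ, (α + γ j * β * ∫ t, g t * w t ∂(densityMeasure D ψ))))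
      ≤ idNorm D ψ K₁ K₂ p q (productWeights γ d) * lqNorm q (fun u : Finset (Fin d) =>
        ENNReal.ofReal ((∏ _j ∈ u, β) * ∏ _j ∈ uᶜ, α)) := by
  have := hψ.isProbabilityMeasure
  have he : ∀ j : Fin d, 0 ≤ α + γ j * β * ∫ t, g t * w t ∂(densityMeasure D ψ) := fun j =>
    add_nonneg hα (mul_nonneg (mul_nonneg (hγ j).le hβ) hℓ)
  have hσ : σ * σ = 1 := by rw [← abs_mul_abs_self, h.abs_eq, one_mul]
  have key := h.componentNorm_le (d := d) hψ hρ hq hγ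
    (G := productFamily (fun j => σ * γ j * β) (fun _ => α) g)
    (H := productFamily (fun j => σ * γ j * β)
      (fun j => α + γ j * β * ∫ t, g t * w t ∂(densityMeasure D ψ)) g)
    (isComponentFamily_productFamily hg) (isComponentFamily_productFamily hg) ?_
  · rw [componentNorm_productFamily hg1 hγ hβ h.abs_eq (fun _ => hα),
      componentNorm_productFamily hg1 hγ hβ h.abs_eq he] at key
    exact key h0 ht
  · ext x
    rw [superpositionSum_productFamily, superpositionSum_productFamily]
    refine Finset.prod_congr rfl fun j _ => ?_
    have h1 : ∫ t, g t * normalizedKernel D ρ K₁ (x j) t ∂(densityMeasure D ψ)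
        = ∫ t, g t * normalizedKernel D ρ K₂ (x j) t ∂(densityMeasure D ψ)
          + σ * ∫ t, g t * w t ∂(densityMeasure D ψ) := by
      have i1 : Integrable (fun t => g t * normalizedKernel D ρ K₂ (x j) t) (densityMeasure D ψ) :=
        hg.integrable_mul (h.right.memLp (x j))
      have i2 : Integrable (fun t => g t * w t) (densityMeasure D ψ) := hg.integrable_mul h.memLp
      rw [← integral_const_mul, ← integral_add i1 (i2.const_mul σ)]
      congr 1; ext t
      rw [h.eq_add]; ring
    rw [h1]
    linear_combination (γ j * β * ∫ t, g t * w t ∂(densityMeasure D ψ)) * hσ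

section LqNorm

variable {d : ℕ}

theorem lqNorm_one (a : Finset (Fin d) → ℝ≥0∞) : lqNorm 1 a = ∑ u, a u := by
  simp [lqNorm]

theorem lqNorm_top (a : Finset (Fin d) → ℝ≥0∞) : lqNorm ∞ a = ⨆ u, a u := by
  simp [lqNorm]

/-- The arithmetic mean over the `2^d` subsets is at most the `q`-mean. -/
theorem sum_mul_lqNorm_one_le {q : ℝ≥0∞} (hq : 1 ≤ q) (a : Finset (Fin d) → ℝ≥0∞) :
    (∑ u, a u) * lqNorm q (fun _ : Finset (Fin d) => 1) ≤ 2 ^ d * lqNorm q a := by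
  have hcard : (Finset.univ : Finset (Finset (Fin d))).card = 2 ^ d := by simp
  rcases eq_or_ne q ∞ with rfl | hqt
  · rw [lqNorm_top, lqNorm_top, iSup_const, mul_one]
    refine (Finset.sum_le_card_nsmul _ _ _ fun u _ => le_iSup a u).trans (le_of_eq ?_)
    rw [hcard, nsmul_eq_mul]; norm_num
  · have hpos := toReal_pos_of_one_le hq hqt
    have h1 : 1 ≤ q.toReal := by simpa using ENNReal.toReal_mono hqt hq
    rw [← ENNReal.rpow_le_rpow_iff hpos]
    simp only [lqNorm, if_neg hqt]
    rw [ENNReal.mul_rpow_of_nonneg _ _ hpos.le, ENNReal.mul_rpow_of_nonneg _ _ hpos.le,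
      ← ENNReal.rpow_mul, ← ENNReal.rpow_mul, one_div_mul_cancel hpos.ne', ENNReal.rpow_one,
      ENNReal.rpow_one]
    refine (mul_le_mul_left (ENNReal.rpow_sum_le_const_mul_sum_rpow Finset.univ a h1) _).trans
      (le_of_eq ?_)
    rw [hcard]
    simp only [ENNReal.one_rpow, Finset.sum_const, hcard, nsmul_eq_mul, mul_one]
    push_cast
    have h2 : (2 : ℝ≥0∞) ^ d ≠ 0 := by positivity
    have h3 : (2 : ℝ≥0∞) ^ d ≠ ∞ := by finiteness
    have h4 : ((2 : ℝ≥0∞) ^ d) ^ q.toReal = (2 ^ d) ^ (q.toReal - 1) * 2 ^ d := by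
      nth_rewrite 3 [← ENNReal.rpow_one ((2 : ℝ≥0∞) ^ d)]
      rw [← ENNReal.rpow_add _ _ h2 h3, sub_add_cancel]
    rw [h4]; ring

end LqNorm

section LowerBound

variable {D : Set ℝ} {ψ : ℝ → ℝ} {ρ : ℝ → ℝ≥0} {p r : ℝ≥0∞} {w : ℝ → ℝ}
  {σ : ℝ} {K₁ K₂ : ℝ → ℝ → ℝ} [p.HolderConjugate r] {γ : ℕ → ℝ} {d : ℕ} {g : ℝ → ℝ}

/-- For `q = 1` take `α = 0`, so that only the full set carries a component; after the change of
kernel the `ℓ_1` sum is the expanded product. For `q = ∞` take `α = 1`: all weighted norms are one,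
and afterwards the component of `∅` is the product. -/
theorem KernelSwitch.prod_one_add_le (h : KernelSwitch D ψ ρ p r w σ K₁ K₂)
    (hψ : IsPositiveDensity D ψ) (hρ : IsRegularVersion D ψ ρ) {q : ℝ≥0∞} (hq : q = 1 ∨ q = ∞)
    (hγ : ∀ j, 0 < γ j) (hg : MemLp g p (densityMeasure D ψ))
    (hg1 : ∀ u : Finset (Fin d), eLpNorm (fun t => ∏ j ∈ u, g (t j)) p
      (Measure.pi fun _ => densityMeasure D ψ) = 1)
    (hℓ : 0 ≤ ∫ t, g t * w t ∂(densityMeasure D ψ)) :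
    ENNReal.ofReal (∏ j : Fin d, (1 + γ j * ∫ t, g t * w t ∂(densityMeasure D ψ)))
      ≤ idNorm D ψ K₁ K₂ p q (productWeights γ d) := by
  set ℓ := ∫ t, g t * w t ∂(densityMeasure D ψ)
  rcases hq with rfl | rfl
  · have e : lqNorm 1 (fun u : Finset (Fin d) =>
        ENNReal.ofReal ((∏ _j ∈ u, (1 : ℝ)) * ∏ _j ∈ uᶜ, (0 : ℝ))) = 1 := by
      rw [lqNorm_one, Finset.sum_eq_single Finset.univ]
      · simp
      · intro u _ hu
        have : uᶜ.card ≠ 0 := by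
          rw [Ne, Finset.card_eq_zero, Finset.compl_eq_empty_iff]; exact hu
        rw [Finset.prod_const 0, zero_pow this]; simp
      · simp
    have key := h.lqNorm_le hψ hρ le_rfl hγ hg hg1 hℓ (α := 0) (β := 1) le_rfl zero_le_one
      (by rw [e]; simp) (by rw [e]; simp)
    rw [e, mul_one, lqNorm_one] at key
    refine le_trans (le_of_eq ?_) key
    rw [← ENNReal.ofReal_sum_of_nonneg fun u _ => ?_]
    · congr 1
      rw [Finset.prod_add, Finset.powerset_univ]
      simp [Finset.compl_eq_univ_sdiff, ℓ]
    · exact mul_nonneg (by simp) (Finset.prod_nonneg fun j _ => by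
        have := mul_nonneg (hγ j).le hℓ
        simpa using this)
  · have e : lqNorm ∞ (fun u : Finset (Fin d) =>
        ENNReal.ofReal ((∏ _j ∈ u, (1 : ℝ)) * ∏ _j ∈ uᶜ, (1 : ℝ))) = 1 := by
      simp [lqNorm_top]
    have key := h.lqNorm_le hψ hρ le_top hγ hg hg1 hℓ (α := 1) (β := 1) zero_le_one zero_le_one
      (by rw [e]; simp) (by rw [e]; simp)
    rw [e, mul_one, lqNorm_top] at key
    refine le_trans (le_of_eq ?_) ((le_iSup _ ∅).trans key)
    simp [ℓ]

/-- Start from weighted norms all equal to one and replace the `q`-mean of the image by its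
arithmetic mean. Each coordinate contributes the average of `1` and `1 + γ_j ℓ`, which explains the
half. -/
theorem KernelSwitch.prod_one_add_half_le (h : KernelSwitch D ψ ρ p r w σ K₁ K₂)
    (hψ : IsPositiveDensity D ψ) (hρ : IsRegularVersion D ψ ρ) {q : ℝ≥0∞} (hq : 1 ≤ q)
    (hγ : ∀ j, 0 < γ j) (hg : MemLp g p (densityMeasure D ψ))
    (hg1 : ∀ u : Finset (Fin d), eLpNorm (fun t => ∏ j ∈ u, g (t j)) p
      (Measure.pi fun _ => densityMeasure D ψ) = 1)
    (hℓ : 0 ≤ ∫ t, g t * w t ∂(densityMeasure D ψ)) :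
    ENNReal.ofReal (∏ j : Fin d, (1 + γ j * (∫ t, g t * w t ∂(densityMeasure D ψ)) / 2))
      ≤ idNorm D ψ K₁ K₂ p q (productWeights γ d) := by
  set ℓ := ∫ t, g t * w t ∂(densityMeasure D ψ) with hℓdef
  have e : (fun u : Finset (Fin d) =>
      ENNReal.ofReal ((∏ _j ∈ u, (1 : ℝ)) * ∏ _j ∈ uᶜ, (1 : ℝ))) = fun _ => 1 := by
    simp
  have h0 : lqNorm q (fun _ : Finset (Fin d) => 1) ≠ 0 := by
    unfold lqNorm
    split_ifs with hqt
    · simp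
    · simp [ENNReal.rpow_eq_zero_iff]
  have ht : lqNorm q (fun _ : Finset (Fin d) => 1) ≠ ∞ := by
    unfold lqNorm
    split_ifs with hqt
    · simp
    · have := toReal_pos_of_one_le hq hqt
      refine ENNReal.rpow_ne_top_of_nonneg (by positivity) ?_
      simp
  have key := h.lqNorm_le hψ hρ hq hγ hg hg1 hℓ (α := 1) (β := 1) zero_le_one zero_le_one
    (by rwa [e]) (by rwa [e])
  rw [e] at key
  have h1 := (sum_mul_lqNorm_one_le hq _).trans (mul_le_mul_right key (2 ^ d))
  rw [← mul_assoc, ENNReal.mul_le_mul_iff_left h0 ht] at h1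
  have hnn : ∀ j : Fin d, 0 ≤ 1 + γ j * ℓ := fun j => by have := mul_nonneg (hγ j).le hℓ; linarith
  have h2 : ∑ u : Finset (Fin d), ENNReal.ofReal ((∏ _j ∈ u, (1 : ℝ)) * ∏ j ∈ uᶜ,
      (1 + γ j * 1 * ℓ)) = 2 ^ d * ENNReal.ofReal (∏ j : Fin d, (1 + γ j * ℓ / 2)) := by
    rw [← ENNReal.ofReal_sum_of_nonneg fun u _ => ?_]
    · have : (2 : ℝ≥0∞) ^ d = ENNReal.ofReal (2 ^ d) := by
        rw [ENNReal.ofReal_pow (by norm_num)]; norm_num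
      rw [this, ← ENNReal.ofReal_mul (by positivity)]
      congr 1
      have h3 : (2 : ℝ) ^ d = ∏ _j : Fin d, 2 := by simp
      rw [h3, ← Finset.prod_mul_distrib]
      have h4 : ∀ j : Fin d, 2 * (1 + γ j * ℓ / 2) = 1 + (1 + γ j * ℓ) := fun j => by ring
      simp_rw [h4]
      rw [Finset.prod_add, Finset.powerset_univ]
      simp [Finset.compl_eq_univ_sdiff]
    · exact mul_nonneg (by simp) (Finset.prod_nonneg fun j _ => by simpa using hnn j)
  rw [h2] at h1
  exact (ENNReal.mul_le_mul_iff_right (by positivity) (by finiteness)).1 h1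

end LowerBound

/-! ### The constants `m_ψ` and `κ_ψ` as norms of the tail ratio -/

section Constants

variable {D : Set ℝ} {ψ : ℝ → ℝ} {ρ : ℝ → ℝ≥0}

/-- Tonelli on the region `t < y`: for `y ∈ D` the admissible `t` form `[0, y)`, of length `y`. -/
theorem lintegral_tail (hD : IsAdmissibleDomain D) (hψ : IsPositiveDensity D ψ)
    (hρ : IsRegularVersion D ψ ρ) :
    ∫⁻ t in D, ENNReal.ofReal (tail D ψ t) = ∫⁻ y in D, ENNReal.ofReal (y * ψ y) := by
  have hDm := hD.measurableSet
  have h1 : ∀ t, ENNReal.ofReal (tail D ψ t)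
      = ∫⁻ y in D, (Ioi t).indicator (fun y => (ρ y : ℝ≥0∞)) y := by
    intro t
    have hsub : volume.restrict (D ∩ Ioi t) ≤ volume.restrict D :=
      Measure.restrict_mono inter_subset_left le_rfl
    rw [tail, ofReal_integral_eq_lintegral_ofReal (hψ.integrable.mono_set inter_subset_left)
      ((ae_restrict_iff' (hDm.inter measurableSet_Ioi)).2 (ae_of_all _ fun y hy => hψ.nonneg y hy.1)),
      lintegral_indicator measurableSet_Ioi, Measure.restrict_restrict measurableSet_Ioi, inter_comm]
    refine lintegral_congr_ae ?_
    filter_upwards [ae_mono (by rwa [inter_comm] at hsub) hρ.ae_eq] with y hy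
    rw [hy, ENNReal.ofReal_coe_nnreal]
  simp_rw [h1]
  have hm : Measurable fun z : ℝ × ℝ => (Ioi z.1).indicator (fun y => (ρ y : ℝ≥0∞)) z.2 := by
    have : (fun z : ℝ × ℝ => (Ioi z.1).indicator (fun y => (ρ y : ℝ≥0∞)) z.2)
        = {z : ℝ × ℝ | z.1 < z.2}.indicator fun z => (ρ z.2 : ℝ≥0∞) := by
      ext z; simp [indicator]
    rw [this]
    exact (hρ.measurable.coe_nnreal_ennreal.comp measurable_snd).indicator
      (measurableSet_lt measurable_fst measurable_snd)
  rw [lintegral_lintegral_swap hm.aemeasurable]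
  refine lintegral_congr_ae ?_
  filter_upwards [hρ.ae_eq, ae_restrict_mem hDm] with y hy hyD
  have h2 : ∀ t, (Ioi t).indicator (fun y => (ρ y : ℝ≥0∞)) y
      = (Iio y).indicator (fun _ => (ρ y : ℝ≥0∞)) t := fun t => by simp [indicator]
  simp_rw [h2]
  rw [lintegral_indicator_const measurableSet_Iio, Measure.restrict_apply measurableSet_Iio]
  have h3 : Iio y ∩ D = Ico 0 y := by
    ext t
    exact ⟨fun ht => ⟨hD.nonneg t ht.2, ht.1⟩, fun ht => ⟨ht.2, hD.mem_of_le y hyD t ht.1 ht.2.le⟩⟩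
  rw [h3, Real.volume_Ico, sub_zero, hy, ENNReal.ofReal_mul (hD.nonneg y hyD),
    ENNReal.ofReal_coe_nnreal, mul_comm]

/-- The comparison is made between lower Lebesgue integrals of nonnegative functions, so
integrability is not needed. -/
theorem integral_tailRatio (hD : IsAdmissibleDomain D) (hψ : IsPositiveDensity D ψ)
    (hρ : IsRegularVersion D ψ ρ) :
    ∫ t, tailRatio D ψ ρ t ∂(densityMeasure D ψ) = mPsi D ψ := by
  have hDm := hD.measurableSet
  have hfin : IsFiniteMeasure ((volume.restrict D).withDensity fun t => (ρ t : ℝ≥0∞)) := by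
    have := hψ.isProbabilityMeasure
    rw [← hρ.densityMeasure_eq]; infer_instance
  rw [hρ.densityMeasure_eq, integral_withDensity_eq_integral_smul hρ.measurable]
  have h1 : ∀ t, ρ t • tailRatio D ψ ρ t = tail D ψ t := fun t => by
    have : (ρ t : ℝ) ≠ 0 := NNReal.coe_ne_zero.2 (hρ.pos t).ne'
    rw [NNReal.smul_def, smul_eq_mul, tailRatio, mul_div_cancel₀ _ this]
  simp_rw [h1]
  rw [mPsi, integral_eq_lintegral_of_nonneg_ae (ae_of_all _ (hψ.tail_nonneg hDm))
    (hψ.antitone_tail hDm).measurable.aestronglyMeasurable,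
    integral_eq_lintegral_of_nonneg_ae ((ae_restrict_iff' hDm).2 (ae_of_all _ fun y hy =>
      mul_nonneg (hD.nonneg y hy) (hψ.nonneg y hy)))
      (measurable_id.aestronglyMeasurable.mul hψ.integrable.1), lintegral_tail hD hψ hρ]

theorem tailRatio_nonneg (hD : IsAdmissibleDomain D) (hψ : IsPositiveDensity D ψ) (t : ℝ) :
    0 ≤ tailRatio D ψ ρ t :=
  div_nonneg (hψ.tail_nonneg hD.measurableSet t) (NNReal.coe_nonneg _)

theorem mPsi_nonneg (hD : IsAdmissibleDomain D) (hψ : IsPositiveDensity D ψ) : 0 ≤ mPsi D ψ :=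
  setIntegral_nonneg hD.measurableSet fun y hy => mul_nonneg (hD.nonneg y hy) (hψ.nonneg y hy)

/-- Integrability of `w` excludes the default value `0` of a divergent integral. If the mean were
`0`, the tail would vanish almost everywhere, hence also `y ψ(y)`, and `D` would be a null set
although `ψ` has mass one. -/
theorem mPsi_pos (hD : IsAdmissibleDomain D) (hψ : IsPositiveDensity D ψ)
    (hρ : IsRegularVersion D ψ ρ) {r : ℝ≥0∞} (hr : 1 ≤ r)
    (hw : MemLp (tailRatio D ψ ρ) r (densityMeasure D ψ)) : 0 < mPsi D ψ := by
  have := hψ.isProbabilityMeasure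
  have hi : Integrable (tailRatio D ψ ρ) (densityMeasure D ψ) := hw.integrable hr
  rw [← integral_tailRatio hD hψ hρ]
  refine (integral_pos_iff_support_of_nonneg (tailRatio_nonneg hD hψ) hi).2 ?_
  rw [pos_iff_ne_zero]
  intro h0
  have hae : tailRatio D ψ ρ =ᵐ[densityMeasure D ψ] 0 := h0
  have htail : ∀ᵐ t ∂(volume.restrict D), ENNReal.ofReal (tail D ψ t) = 0 := by
    filter_upwards [hρ.absolutelyContinuous.ae_le hae] with t ht
    have h2 : (ρ t : ℝ) ≠ 0 := NNReal.coe_ne_zero.2 (hρ.pos t).ne'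
    have h3 : tail D ψ t = 0 := (div_eq_zero_iff.1 ht).resolve_right h2
    rw [h3, ENNReal.ofReal_zero]
  have h4 := lintegral_tail hD hψ hρ
  have hmeas : AEMeasurable (fun y => ENNReal.ofReal (y * ψ y)) (volume.restrict D) :=
    (measurable_id.aemeasurable.mul hψ.integrable.1.aemeasurable).ennreal_ofReal
  rw [lintegral_congr_ae htail, lintegral_zero, eq_comm, lintegral_eq_zero_iff' hmeas] at h4
  have h5 : ∀ᵐ t : ℝ ∂(volume.restrict D), t ≠ 0 := ae_restrict_of_ae (by simp [ae_iff])
  have h6 : ∀ᵐ _t ∂(volume.restrict D), False := by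
    filter_upwards [h4, h5, hψ.pos_ae, ae_restrict_mem hD.measurableSet] with t h h' hp hD'
    have : 0 < t * ψ t := mul_pos (lt_of_le_of_ne (hD.nonneg t hD') h'.symm) hp
    simp only [Pi.zero_apply, ENNReal.ofReal_eq_zero] at h
    exact absurd h (not_le.2 this)
  have h7 : volume.restrict D = 0 := by simpa using h6
  have h8 := hψ.integral_eq_one
  rw [h7, integral_zero_measure] at h8
  exact zero_ne_one h8

theorem eLpNorm_tailRatio_one (hD : IsAdmissibleDomain D) (hψ : IsPositiveDensity D ψ)
    (hρ : IsRegularVersion D ψ ρ) (hw : MemLp (tailRatio D ψ ρ) 1 (densityMeasure D ψ)) :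
    eLpNorm (tailRatio D ψ ρ) 1 (densityMeasure D ψ) = ENNReal.ofReal (mPsi D ψ) := by
  rw [eLpNorm_one_eq_lintegral_enorm, ← integral_tailRatio hD hψ hρ,
    ofReal_integral_eq_lintegral_ofReal (memLp_one_iff_integrable.1 hw)
      (ae_of_all _ (tailRatio_nonneg hD hψ))]
  congr 1; ext t
  exact Real.enorm_of_nonneg (tailRatio_nonneg hD hψ t)

/-- `ψ(t) dt` and Lebesgue measure on `D` have the same null sets, hence the same essential suprema.
-/
theorem eLpNorm_tailRatio_top (hρ : IsRegularVersion D ψ ρ)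
    (hw : MemLp (tailRatio D ψ ρ) ∞ (densityMeasure D ψ)) :
    eLpNorm (tailRatio D ψ ρ) ∞ (densityMeasure D ψ) = ENNReal.ofReal (kappaPsi D ψ) := by
  have h1 : eLpNorm (tailRatio D ψ ρ) ∞ (densityMeasure D ψ)
      = eLpNorm (fun t => tail D ψ t / ψ t) ∞ (volume.restrict D) := by
    have h2 : eLpNorm (fun t => tail D ψ t / ψ t) ∞ (volume.restrict D)
        = eLpNorm (tailRatio D ψ ρ) ∞ (volume.restrict D) := by
      refine eLpNorm_congr_ae ?_
      filter_upwards [hρ.ae_eq] with t ht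
      rw [ht, tailRatio]
    rw [h2, eLpNorm_exponent_top, eLpNorm_exponent_top]
    exact le_antisymm (essSup_mono_measure (withDensity_absolutelyContinuous _ _))
      (essSup_mono_measure hρ.absolutelyContinuous)
  rw [kappaPsi, ← h1, ENNReal.ofReal_toReal hw.2.ne]

end Constants

/-! ### Test functions of norm one -/

section TestFunctions

variable {ν : Measure ℝ} [IsProbabilityMeasure ν] {d : ℕ}

theorem eLpNorm_prod_one {p : ℝ≥0∞} (hp : 1 ≤ p) (u : Finset (Fin d)) :
    eLpNorm (fun _ : Fin d → ℝ => ∏ _j ∈ u, (1 : ℝ)) p (Measure.pi fun _ => ν) = 1 := by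
  simp only [Finset.prod_const_one]
  rw [eLpNorm_const _ (zero_lt_one.trans_le hp).ne' (NeZero.ne _)]
  simp

theorem eLpNorm_one_prod_of_integral_eq_one {g : ℝ → ℝ} (hg : Integrable g ν) (h0 : ∀ t, 0 ≤ g t)
    (h1 : ∫ t, g t ∂ν = 1) (u : Finset (Fin d)) :
    eLpNorm (fun t : Fin d → ℝ => ∏ j ∈ u, g (t j)) 1 (Measure.pi fun _ => ν) = 1 := by
  have hi : Integrable (fun t : Fin d → ℝ => ∏ j ∈ u, g (t j)) (Measure.pi fun _ => ν) :=
    memLp_one_iff_integrable.1 (MemLp.prod_coordinates fun _ _ => memLp_one_iff_integrable.2 hg)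
  have hnn : ∀ t : Fin d → ℝ, 0 ≤ ∏ j ∈ u, g (t j) := fun t => Finset.prod_nonneg fun j _ => h0 _
  have hint : ∫ t : Fin d → ℝ, ∏ j ∈ u, g (t j) ∂(Measure.pi fun _ => ν) = 1 := by
    have e : ∀ t : Fin d → ℝ, ∏ j ∈ u, g (t j) = ∏ j, if j ∈ u then g (t j) else 1 := by simp
    simp_rw [e]
    rw [integral_fintype_prod_eq_prod (μ := fun _ => ν) (f := fun j s => if j ∈ u then g s else 1)]
    refine Finset.prod_eq_one fun j _ => ?_
    split_ifs
    · exact h1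
    · simp
  rw [eLpNorm_one_eq_lintegral_enorm, ← ENNReal.ofReal_one, ← hint,
    ofReal_integral_eq_lintegral_ofReal hi (ae_of_all _ hnn)]
  congr 1; ext t
  exact Real.enorm_of_nonneg (hnn t)

/-- An `L_1` function of norm one on which the functional given by `w` almost attains its norm. -/
theorem exists_test_function {w : ℝ → ℝ} (hw : MemLp w ∞ ν) (hwm : Measurable w) (hw0 : ∀ t, 0 ≤ w t)
    {ℓ : ℝ} (hℓ : ENNReal.ofReal ℓ < eLpNorm w ∞ ν) :
    ∃ g, Integrable g ν ∧ (∀ t, 0 ≤ g t) ∧ ∫ t, g t ∂ν = 1 ∧ ℓ ≤ ∫ t, g t * w t ∂ν := by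
  set B := {t | ℓ < w t} with hB
  have hBm : MeasurableSet B := measurableSet_lt measurable_const hwm
  have hνB : ν B ≠ 0 := by
    intro h0
    refine absurd hℓ (not_lt.2 ?_)
    rw [eLpNorm_exponent_top]
    refine essSup_le_of_ae_le _ ?_
    have : ∀ᵐ t ∂ν, t ∉ B := measure_eq_zero_iff_ae_notMem.1 h0
    filter_upwards [this] with t ht
    rw [Real.enorm_of_nonneg (hw0 t)]
    exact ENNReal.ofReal_le_ofReal (not_lt.1 ht)
  have hpos : 0 < ν.real B := ENNReal.toReal_pos hνB (measure_ne_top _ _)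
  -- `B` has positive measure because `ℓ` is below the essential supremum, so the mean of `w` over
  -- `B` is at least `ℓ`.
  set g : ℝ → ℝ := B.indicator fun _ => (ν.real B)⁻¹ with hg
  have hgi : Integrable g ν := (integrable_const _).indicator hBm
  have hg0 : ∀ t, 0 ≤ g t := fun t => indicator_nonneg (fun _ _ => inv_nonneg.2 hpos.le) t
  have hg1 : ∫ t, g t ∂ν = 1 := by
    rw [hg, integral_indicator_const _ hBm, smul_eq_mul, mul_inv_cancel₀ hpos.ne']
  refine ⟨g, hgi, hg0, hg1, ?_⟩
  have hgw : Integrable (fun t => g t * w t) ν :=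
    (memLp_one_iff_integrable.2 hgi).integrable_mul hw
  calc ℓ = ∫ t, g t * ℓ ∂ν := by rw [integral_mul_const, hg1, one_mul]
    _ ≤ _ := by
      refine integral_mono (hgi.mul_const ℓ) hgw fun t => ?_
      by_cases ht : t ∈ B
      · exact mul_le_mul_of_nonneg_left (le_of_lt ht) (hg0 t)
      · simp [hg, indicator_of_notMem ht]

end TestFunctions

/-! ### The extremal constants for product weights -/

section ExtremalConst

theorem productWeights_pos {γ : ℕ → ℝ} (hγ : ∀ j, 0 < γ j) (d : ℕ) (u : Finset (Fin d)) :
    0 < productWeights γ d u := Finset.prod_pos fun i _ => hγ i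

theorem prod_le_prod_univ {d : ℕ} {a : Fin d → ℝ} (ha : ∀ j, 1 ≤ a j) (u : Finset (Fin d)) :
    ∏ j ∈ u, a j ≤ ∏ j, a j := by
  have : ∏ j ∈ u, a j = ∏ j, if j ∈ u then a j else 1 := by simp
  rw [this]
  refine Finset.prod_le_prod (fun j _ => ?_) fun j _ => ?_ <;> split_ifs
  exacts [zero_le_one.trans (ha j), zero_le_one, le_rfl, ha j]

theorem sup'_prod_compl {d : ℕ} {a : Fin d → ℝ} (ha : ∀ j, 1 ≤ a j) :
    (Finset.univ.sup' Finset.univ_nonempty fun u : Finset (Fin d) => ∏ j ∈ uᶜ, a j) = ∏ j, a j := by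
  refine le_antisymm (Finset.sup'_le _ _ fun u _ => ?_) ?_
  · exact prod_le_prod_univ ha _
  · refine le_trans (le_of_eq ?_) (Finset.le_sup' _ (Finset.mem_univ ∅))
    simp

theorem sup'_prod {d : ℕ} {a : Fin d → ℝ} (ha : ∀ j, 1 ≤ a j) :
    (Finset.univ.sup' Finset.univ_nonempty fun u : Finset (Fin d) => ∏ j ∈ u, a j) = ∏ j, a j := by
  refine le_antisymm (Finset.sup'_le _ _ fun u _ => ?_) ?_
  · exact prod_le_prod_univ ha _
  · exact Finset.le_sup' (fun u : Finset (Fin d) => ∏ j ∈ u, a j) (Finset.mem_univ Finset.univ)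

/-- The quotients of weights are `γ_v` and `γ_{v \ u}`, so each inner sum expands a product of
factors `1 + c γ_j ≥ 1`, over `uᶜ` and `v` respectively. The maxima are attained at `u = ∅` and at
the full set `v`. -/
theorem extremalConst_productWeights {D : Set ℝ} {ψ : ℝ → ℝ} {p q : ℝ≥0∞} {γ : ℕ → ℝ}
    (hγ : ∀ j, 0 < γ j) (d : ℕ) {c : ℝ} (hc : (if p = ∞ then mPsi D ψ else kappaPsi D ψ) = c)
    (hc0 : 0 ≤ c) :
    extremalConst D ψ p q (productWeights γ d) = ∏ j ∈ Finset.range d, (1 + c * γ j) := by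
  have hpos := productWeights_pos hγ d
  have h1 : ∀ j : Fin d, 1 ≤ 1 + c * γ j := fun j => by
    have := mul_nonneg hc0 (hγ j).le; linarith
  rw [Finset.prod_range]
  simp only [extremalConst, hc]
  split_ifs
  · rw [← sup'_prod_compl h1]
    congr 1; ext u
    rw [Finset.prod_one_add]
    refine Finset.sum_congr rfl fun v hv => ?_
    have hd : Disjoint u v := by
      rw [Finset.mem_powerset] at hv
      exact (Finset.disjoint_left.2 fun j hj hjv => Finset.mem_compl.1 (hv hjv) hj)
    rw [Finset.prod_mul_distrib, Finset.prod_const]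
    congr 1
    rw [div_eq_iff (hpos u).ne']
    simp only [productWeights]
    rw [Finset.prod_union hd, mul_comm]
  · rw [← sup'_prod h1]
    congr 1; ext v
    rw [Finset.prod_add]
    refine Finset.sum_congr rfl fun u hu => ?_
    have hsub : u ⊆ v := Finset.mem_powerset.1 hu
    rw [Finset.prod_const_one, one_mul, Finset.prod_mul_distrib, Finset.prod_const,
      Finset.card_sdiff_of_subset hsub]
    congr 1
    rw [div_eq_iff (hpos u).ne']
    exact (Finset.prod_sdiff hsub).symm

end ExtremalConst

/-! ### Growth of products and of partial sums -/

section Sequences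

variable {γ : ℕ → ℝ}

theorem prod_one_add_le_exp {c : ℝ} (hc : 0 ≤ c) (hγ : ∀ j, 0 < γ j) (d : ℕ) :
    ∏ j ∈ Finset.range d, (1 + c * γ j) ≤ Real.exp (c * ∑ j ∈ Finset.range d, γ j) := by
  rw [Finset.mul_sum, Real.exp_sum]
  refine Finset.prod_le_prod (fun j _ => ?_) fun j _ => ?_
  · have := mul_nonneg hc (hγ j).le; linarith
  · rw [add_comm]; exact Real.add_one_le_exp _

theorem sum_le_prod_one_add {a : ℝ} (ha : 0 < a) (hγ : ∀ j, 0 < γ j) (d : ℕ) :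
    1 + a * ∑ j ∈ Finset.range d, γ j ≤ ∏ j ∈ Finset.range d, (1 + a * γ j) := by
  induction d with
  | zero => simp
  | succ d ih =>
    rw [Finset.sum_range_succ, Finset.prod_range_succ]
    have h1 : 0 ≤ a * ∑ j ∈ Finset.range d, γ j :=
      mul_nonneg ha.le (Finset.sum_nonneg fun j _ => (hγ j).le)
    have h2 : 0 < a * γ d := mul_pos ha (hγ d)
    nlinarith [mul_nonneg h1 h2.le]

/-- The summand `1` keeps the exponent positive even if `c B = 0`; the constant comes from `d + 1 ≤
2 d`. -/
theorem exp_le_mul_rpow {c B : ℝ} (hc : 0 ≤ c) (hB : 0 ≤ B) {d : ℕ} (hd : 1 ≤ d) {s : ℝ}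
    (hs : s ≤ B * Real.log (d + 1)) :
    Real.exp (c * s) ≤ 2 ^ (c * B + 1) * (d : ℝ) ^ (c * B + 1) := by
  have hd' : (1 : ℝ) ≤ d := by exact_mod_cast hd
  have hτ : 0 ≤ c * B + 1 := by positivity
  calc Real.exp (c * s) ≤ Real.exp ((c * B + 1) * Real.log (d + 1)) := by
        refine Real.exp_le_exp.2 ?_
        have h1 := mul_le_mul_of_nonneg_left hs hc
        have h2 : 0 ≤ Real.log (d + 1) := Real.log_nonneg (by linarith)
        nlinarith
    _ = ((d : ℝ) + 1) ^ (c * B + 1) := by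
        rw [mul_comm, ← Real.rpow_def_of_pos (by linarith)]
    _ ≤ (2 * d) ^ (c * B + 1) := Real.rpow_le_rpow (by linarith) (by linarith) hτ
    _ = _ := Real.mul_rpow (by norm_num) (by linarith)

/-- Uses `log (1 + x) ≥ x / (1 + x)` with `x = a γ_j`. Boundedness of the weights makes the
denominators uniform. -/
theorem mul_sum_le_log_prod {a M : ℝ} (ha : 0 < a) (hγ : ∀ j, 0 < γ j) (hM : ∀ j, γ j ≤ M) (d : ℕ) :
    a / (1 + a * M) * ∑ j ∈ Finset.range d, γ j
      ≤ Real.log (∏ j ∈ Finset.range d, (1 + a * γ j)) := by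
  have hpos : ∀ j, 0 < 1 + a * γ j := fun j => by have := mul_pos ha (hγ j); linarith
  rw [Real.log_prod fun j _ => (hpos j).ne', Finset.mul_sum]
  refine Finset.sum_le_sum fun j _ => ?_
  refine le_trans ?_ (Real.one_sub_inv_le_log_of_pos (hpos j))
  have h1 : 1 - (1 + a * γ j)⁻¹ = a / (1 + a * γ j) * γ j := by
    have := (hpos j).ne'
    field_simp
    ring
  rw [h1]
  have := hγ j
  have := hpos j
  gcongr
  exact hM j

theorem bddAbove_sum_div_log {a M C τ : ℝ} (ha : 0 < a) (hγ : ∀ j, 0 < γ j) (hM : ∀ j, γ j ≤ M)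
    (hτ : 0 < τ) (h : ∀ᶠ d : ℕ in Filter.atTop,
      ∏ j ∈ Finset.range d, (1 + a * γ j) ≤ C * (d : ℝ) ^ τ) :
    BddAbove ((fun d : ℕ => (∑ j ∈ Finset.range d, γ j) / Real.log (d + 1)) '' Set.Ici 1) := by
  obtain ⟨N, hN⟩ := Filter.eventually_atTop.1 h
  have hM0 : 0 < M := (hγ 0).trans_le (hM 0)
  have hl2 : 0 < Real.log 2 := Real.log_pos (by norm_num)
  set b := a / (1 + a * M) with hb
  have hbpos : 0 < b := by positivity
  -- The first bound serves the finitely many `d ≤ N`. The second comes from taking logarithms for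
  -- `d ≥ N`, where `log 2 ≤ log (d + 1)` absorbs the constant `log C`.
  refine ⟨max ((∑ j ∈ Finset.range N, γ j) / Real.log 2)
    (b⁻¹ * (|Real.log C| / Real.log 2 + τ)), ?_⟩
  rintro _ ⟨d, hd, rfl⟩
  have hd1 : (1 : ℝ) ≤ d := by exact_mod_cast hd
  have hlog : Real.log 2 ≤ Real.log (d + 1) := Real.log_le_log (by norm_num) (by linarith)
  have hlpos : 0 < Real.log (d + 1) := hl2.trans_le hlog
  rcases le_total d N with hdN | hNd
  · refine le_max_of_le_left ?_
    refine div_le_div₀ (Finset.sum_nonneg fun j _ => (hγ j).le) ?_ hl2 hlog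
    exact Finset.sum_le_sum_of_subset_of_nonneg (Finset.range_mono hdN) fun j _ _ => (hγ j).le
  · refine le_max_of_le_right ?_
    have hP := hN d hNd
    have hPpos : 0 < ∏ j ∈ Finset.range d, (1 + a * γ j) :=
      Finset.prod_pos fun j _ => by have := mul_pos ha (hγ j); linarith
    have hdτ : 0 < (d : ℝ) ^ τ := Real.rpow_pos_of_pos (by linarith) _
    have hC : 0 < C := pos_of_mul_pos_left (hPpos.trans_le hP) hdτ.le
    have h1 := (mul_sum_le_log_prod ha hγ hM d).trans (Real.log_le_log hPpos hP)
    rw [Real.log_mul hC.ne' hdτ.ne', Real.log_rpow (by linarith)] at h1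
    have h2 : Real.log C ≤ |Real.log C| / Real.log 2 * Real.log (d + 1) := by
      refine (le_abs_self _).trans ?_
      rw [div_mul_eq_mul_div, le_div_iff₀ hl2]
      exact mul_le_mul_of_nonneg_left hlog (abs_nonneg _)
    have h3 : τ * Real.log d ≤ τ * Real.log (d + 1) :=
      mul_le_mul_of_nonneg_left (Real.log_le_log (by linarith) (by linarith)) hτ.le
    rw [div_le_iff₀ hlpos, mul_assoc, ← div_eq_inv_mul, le_div_iff₀ hbpos, mul_comm, add_mul]
    linarith

end Sequences

/-! ### Two-sided bounds for the embedding and its inverse -/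

section Embedding

variable {D : Set ℝ} {ψ : ℝ → ℝ} {ρ : ℝ → ℝ≥0} {p q r : ℝ≥0∞} [p.HolderConjugate r] {γ : ℕ → ℝ}

theorem kernelSwitch_anova_anchored (hD : IsAdmissibleDomain D) (hψ : IsPositiveDensity D ψ)
    (hρ : IsRegularVersion D ψ ρ) (hp : 1 ≤ p) (hI : IntegrabilityCondition D ψ p) :
    KernelSwitch D ψ ρ p r (tailRatio D ψ ρ) (-1) (anovaKernel D ψ) anchoredKernel := by
  have hw : MemLp (tailRatio D ψ ρ) r (densityMeasure D ψ) := memLp_tailRatio hD hψ hρ hp hI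
  have hK : IsUniqueKernel D ψ ρ p r anchoredKernel := isUniqueKernel_anchored hD hψ hρ
    (memLp_normalizedKernel_anchored hD hρ hp hI)
  exact ⟨hw, by norm_num, normalizedKernel_anova, isUniqueKernel_anova hp hψ hw hK, hK⟩

variable {w : ℝ → ℝ} {σ : ℝ} {K₁ K₂ : ℝ → ℝ → ℝ}

theorem KernelSwitch.idNorm_le_ofReal (h : KernelSwitch D ψ ρ p r w σ K₁ K₂)
    (hψ : IsPositiveDensity D ψ) (hρ : IsRegularVersion D ψ ρ) (hp : 1 ≤ p) (hq : 1 ≤ q)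
    (hγ : ∀ j, 0 < γ j) {c : ℝ} (hc0 : 0 ≤ c)
    (hc : eLpNorm w r (densityMeasure D ψ) = ENNReal.ofReal c) (d : ℕ) :
    idNorm D ψ K₁ K₂ p q (productWeights γ d)
      ≤ ENNReal.ofReal (∏ j ∈ Finset.range d, (1 + c * γ j)) := by
  refine (h.idNorm_le hψ hρ hp hq hγ).trans (le_of_eq ?_)
  have hnn : ∀ j : Fin d, 0 ≤ c * γ j := fun j => mul_nonneg hc0 (hγ j).le
  rw [Finset.prod_range, ENNReal.ofReal_prod_of_nonneg fun j _ => add_nonneg zero_le_one (hnn j), hc]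
  refine Finset.prod_congr rfl fun j _ => ?_
  rw [ENNReal.ofReal_add zero_le_one (hnn j), ENNReal.ofReal_one, ENNReal.ofReal_mul hc0]

theorem KernelSwitch.prod_mPsi_le (h : KernelSwitch D ψ ρ p r (tailRatio D ψ ρ) σ K₁ K₂)
    (hD : IsAdmissibleDomain D) (hψ : IsPositiveDensity D ψ) (hρ : IsRegularVersion D ψ ρ)
    (hp : 1 ≤ p) (hq : q = 1 ∨ q = ∞) (hγ : ∀ j, 0 < γ j) (d : ℕ) :
    ENNReal.ofReal (∏ j ∈ Finset.range d, (1 + mPsi D ψ * γ j))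
      ≤ idNorm D ψ K₁ K₂ p q (productWeights γ d) := by
  have := hψ.isProbabilityMeasure
  have hm : ∫ t, (fun _ => (1 : ℝ)) t * tailRatio D ψ ρ t ∂(densityMeasure D ψ) = mPsi D ψ := by
    simp only [one_mul]; exact integral_tailRatio hD hψ hρ
  have key := h.prod_one_add_le (d := d) hψ hρ hq hγ (g := fun _ => 1) (memLp_const 1)
    (eLpNorm_prod_one hp) (by rw [hm]; exact mPsi_nonneg hD hψ)
  rw [hm] at key
  rw [Finset.prod_range]
  simpa only [mul_comm] using key

theorem KernelSwitch.prod_mPsi_div_two_le (h : KernelSwitch D ψ ρ p r (tailRatio D ψ ρ) σ K₁ K₂)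
    (hD : IsAdmissibleDomain D) (hψ : IsPositiveDensity D ψ) (hρ : IsRegularVersion D ψ ρ)
    (hp : 1 ≤ p) (hq : 1 ≤ q) (hγ : ∀ j, 0 < γ j) (d : ℕ) :
    ENNReal.ofReal (∏ j ∈ Finset.range d, (1 + mPsi D ψ / 2 * γ j))
      ≤ idNorm D ψ K₁ K₂ p q (productWeights γ d) := by
  have := hψ.isProbabilityMeasure
  have hm : ∫ t, (fun _ => (1 : ℝ)) t * tailRatio D ψ ρ t ∂(densityMeasure D ψ) = mPsi D ψ := by
    simp only [one_mul]; exact integral_tailRatio hD hψ hρ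
  have key := h.prod_one_add_half_le (d := d) hψ hρ hq hγ (g := fun _ => 1) (memLp_const 1)
    (eLpNorm_prod_one hp) (by rw [hm]; exact mPsi_nonneg hD hψ)
  rw [hm] at key
  rw [Finset.prod_range]
  simpa only [mul_comm, mul_div_assoc] using key

theorem measurable_tailRatio (hD : IsAdmissibleDomain D) (hψ : IsPositiveDensity D ψ)
    (hρ : IsRegularVersion D ψ ρ) : Measurable (tailRatio D ψ ρ) :=
  (hψ.antitone_tail hD.measurableSet).measurable.div hρ.measurable.coe_nnreal_real

theorem KernelSwitch.prod_kappaPsi_le (h : KernelSwitch D ψ ρ 1 ∞ (tailRatio D ψ ρ) σ K₁ K₂)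
    (hD : IsAdmissibleDomain D) (hψ : IsPositiveDensity D ψ) (hρ : IsRegularVersion D ψ ρ)
    (hq : q = 1 ∨ q = ∞) (hγ : ∀ j, 0 < γ j) (d : ℕ) :
    ENNReal.ofReal (∏ j ∈ Finset.range d, (1 + kappaPsi D ψ * γ j))
      ≤ idNorm D ψ K₁ K₂ 1 q (productWeights γ d) := by
  have := hψ.isProbabilityMeasure
  have hκ := eLpNorm_tailRatio_top hρ h.memLp
  -- Positivity makes `[0, κ_ψ)` a left neighbourhood of `κ_ψ`; if `κ_ψ` were `0`, then `w` and so
  -- `m_ψ` would vanish.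
  have hκ0 : 0 < kappaPsi D ψ := by
    rw [← ENNReal.ofReal_pos, ← hκ, pos_iff_ne_zero]
    intro h0
    have hae := (eLpNorm_eq_zero_iff h.memLp.1 (by simp)).1 h0
    have := mPsi_pos hD hψ hρ le_top h.memLp
    rw [← integral_tailRatio hD hψ hρ, integral_eq_zero_of_ae hae] at this
    exact lt_irrefl _ this
  -- The essential supremum need not be attained, so the bound is proved for `ℓ < κ_ψ` and passed to
  -- the limit.
  have hlim : Filter.Tendsto
      (fun ℓ : ℝ => ENNReal.ofReal (∏ j ∈ Finset.range d, (1 + ℓ * γ j)))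
      (nhdsWithin (kappaPsi D ψ) (Iio (kappaPsi D ψ)))
      (nhds (ENNReal.ofReal (∏ j ∈ Finset.range d, (1 + kappaPsi D ψ * γ j)))) := by
    refine ENNReal.tendsto_ofReal (Filter.Tendsto.mono_left ?_ nhdsWithin_le_nhds)
    have : Continuous fun ℓ : ℝ => ∏ j ∈ Finset.range d, (1 + ℓ * γ j) := by fun_prop
    exact this.tendsto _
  refine le_of_tendsto hlim ?_
  filter_upwards [Ico_mem_nhdsLT hκ0] with ℓ hℓ
  obtain ⟨g, hgi, hg0, hg1, hgℓ⟩ := exists_test_function h.memLp (measurable_tailRatio hD hψ hρ)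
    (tailRatio_nonneg hD hψ) (ℓ := ℓ)
    (by rw [hκ]; exact (ENNReal.ofReal_lt_ofReal_iff hκ0).2 hℓ.2)
  refine le_trans (ENNReal.ofReal_le_ofReal ?_) (h.prod_one_add_le (d := d) hψ hρ hq hγ
    (memLp_one_iff_integrable.2 hgi) (eLpNorm_one_prod_of_integral_eq_one hgi hg0 hg1)
    (hℓ.1.trans hgℓ))
  rw [Finset.prod_range]
  refine Finset.prod_le_prod (fun j _ => ?_) fun j _ => ?_
  · have := mul_nonneg hℓ.1 (hγ j).le; linarith
  · rw [mul_comm ℓ]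
    have := mul_le_mul_of_nonneg_left hgℓ (hγ j).le
    linarith

end Embedding

end AnchoredANOVA

/-- The sequence of weights is `γ 0, γ 1, …`, that is, `γ j` is the weight of the coordinate
with number `j + 1` in one-based numbering. -/
theorem mainTheorem8 (D : Set ℝ) (ψ : ℝ → ℝ)
    (hD : AnchoredANOVA.IsAdmissibleDomain D) (hψ : AnchoredANOVA.IsPositiveDensity D ψ)
    (γ : ℕ → ℝ) (hγ : ∀ j, 0 < γ j) :
    -- the case `p = ∞`, `q ∈ {1, ∞}`
    (AnchoredANOVA.IntegrabilityCondition D ψ ∞ →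
      ∀ d : ℕ, 1 ≤ d → ∀ q : ℝ≥0∞, q = 1 ∨ q = ∞ →
        AnchoredANOVA.extremalConst D ψ ∞ q (AnchoredANOVA.productWeights γ d)
            = ∏ j ∈ Finset.range d, (1 + AnchoredANOVA.mPsi D ψ * γ j) ∧
        AnchoredANOVA.embNorm D ψ ∞ q (AnchoredANOVA.productWeights γ d)
            = ENNReal.ofReal
                (AnchoredANOVA.extremalConst D ψ ∞ q (AnchoredANOVA.productWeights γ d)) ∧
        AnchoredANOVA.embInvNorm D ψ ∞ q (AnchoredANOVA.productWeights γ d)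
            = ENNReal.ofReal
                (AnchoredANOVA.extremalConst D ψ ∞ q (AnchoredANOVA.productWeights γ d))) ∧
    -- the case `p = 1`, `q ∈ {1, ∞}`
    (AnchoredANOVA.IntegrabilityCondition D ψ 1 →
      ∀ d : ℕ, 1 ≤ d → ∀ q : ℝ≥0∞, q = 1 ∨ q = ∞ →
        AnchoredANOVA.extremalConst D ψ 1 q (AnchoredANOVA.productWeights γ d)
            = ∏ j ∈ Finset.range d, (1 + AnchoredANOVA.kappaPsi D ψ * γ j) ∧
        AnchoredANOVA.embNorm D ψ 1 q (AnchoredANOVA.productWeights γ d)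
            = ENNReal.ofReal
                (AnchoredANOVA.extremalConst D ψ 1 q (AnchoredANOVA.productWeights γ d)) ∧
        AnchoredANOVA.embInvNorm D ψ 1 q (AnchoredANOVA.productWeights γ d)
            = ENNReal.ofReal
                (AnchoredANOVA.extremalConst D ψ 1 q (AnchoredANOVA.productWeights γ d))) ∧
    -- all `p, q ∈ [1, ∞]`
    (∀ p q : ℝ≥0∞, 1 ≤ p → 1 ≤ q → AnchoredANOVA.IntegrabilityCondition D ψ p →
      -- the spaces agree, and the embedding and its inverse have the same norm
      (∀ d : ℕ, 1 ≤ d →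
        AnchoredANOVA.weightedSpace D ψ AnchoredANOVA.anchoredKernel p (AnchoredANOVA.productWeights γ d)
          = AnchoredANOVA.weightedSpace D ψ (AnchoredANOVA.anovaKernel D ψ) p
              (AnchoredANOVA.productWeights γ d) ∧
        AnchoredANOVA.embNorm D ψ p q (AnchoredANOVA.productWeights γ d)
          = AnchoredANOVA.embInvNorm D ψ p q (AnchoredANOVA.productWeights γ d)) ∧
      -- uniform equivalence: sufficiency and necessity
      (Summable γ →
        AnchoredANOVA.UniformlyEquivalent D ψ p q (AnchoredANOVA.productWeights γ)) ∧
      (AnchoredANOVA.UniformlyEquivalent D ψ p q (AnchoredANOVA.productWeights γ) →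
        Summable γ) ∧
      -- polynomial equivalence: sufficiency, and necessity for bounded `γ`
      (BddAbove ((fun d : ℕ => (∑ j ∈ Finset.range d, γ j) / Real.log (d + 1)) '' Set.Ici 1) →
        AnchoredANOVA.PolynomiallyEquivalent D ψ p q (AnchoredANOVA.productWeights γ)) ∧
      (BddAbove (Set.range γ) →
        AnchoredANOVA.PolynomiallyEquivalent D ψ p q (AnchoredANOVA.productWeights γ) →
        BddAbove
          ((fun d : ℕ => (∑ j ∈ Finset.range d, γ j) / Real.log (d + 1)) '' Set.Ici 1))) := by
  obtain ⟨ρ, hρ⟩ := hψ.exists_isRegularVersion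
  refine ⟨fun hI d hd q hq => ?_, fun hI d hd q hq => ?_, fun p q hp hq hI => ?_⟩
  · have h1q : 1 ≤ q := by rcases hq with rfl | rfl <;> simp
    have h := AnchoredANOVA.kernelSwitch_anova_anchored (r := 1) hD hψ hρ le_top hI
    have hm := AnchoredANOVA.mPsi_nonneg hD hψ
    have hc := AnchoredANOVA.eLpNorm_tailRatio_one hD hψ hρ h.memLp
    have hC := AnchoredANOVA.extremalConst_productWeights (D := D) (ψ := ψ) (p := ∞) (q := q) hγ d
      (if_pos rfl) hm
    refine ⟨hC, ?_, ?_⟩ <;> rw [hC]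
    · exact le_antisymm (h.idNorm_le_ofReal hψ hρ le_top h1q hγ hm hc d)
        (h.prod_mPsi_le hD hψ hρ le_top hq hγ d)
    · exact le_antisymm (h.symm.idNorm_le_ofReal hψ hρ le_top h1q hγ hm hc d)
        (h.symm.prod_mPsi_le hD hψ hρ le_top hq hγ d)
  · have h1q : 1 ≤ q := by rcases hq with rfl | rfl <;> simp
    have h := AnchoredANOVA.kernelSwitch_anova_anchored (r := ∞) hD hψ hρ le_rfl hI
    have hκ : 0 ≤ AnchoredANOVA.kappaPsi D ψ := ENNReal.toReal_nonneg
    have hc := AnchoredANOVA.eLpNorm_tailRatio_top hρ h.memLp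
    have hC := AnchoredANOVA.extremalConst_productWeights (D := D) (ψ := ψ) (p := 1) (q := q) hγ d
      (if_neg ENNReal.one_ne_top) hκ
    refine ⟨hC, ?_, ?_⟩ <;> rw [hC]
    · exact le_antisymm (h.idNorm_le_ofReal hψ hρ le_rfl h1q hγ hκ hc d)
        (h.prod_kappaPsi_le hD hψ hρ hq hγ d)
    · exact le_antisymm (h.symm.idNorm_le_ofReal hψ hρ le_rfl h1q hγ hκ hc d)
        (h.symm.prod_kappaPsi_le hD hψ hρ hq hγ d)
  · have hconj : p.HolderConjugate (ENNReal.conjExponent p) :=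
      ENNReal.HolderConjugate.conjExponent hp
    have h1r : 1 ≤ ENNReal.conjExponent p := le_self_add
    have h := AnchoredANOVA.kernelSwitch_anova_anchored (r := ENNReal.conjExponent p) hD hψ hρ hp hI
    have hm := AnchoredANOVA.mPsi_pos hD hψ hρ h1r h.memLp
    obtain ⟨c, hc0, hc⟩ : ∃ c : ℝ, 0 ≤ c ∧
        eLpNorm (AnchoredANOVA.tailRatio D ψ ρ) (ENNReal.conjExponent p)
          (AnchoredANOVA.densityMeasure D ψ) = ENNReal.ofReal c :=
      ⟨_, ENNReal.toReal_nonneg, (ENNReal.ofReal_toReal h.memLp.2.ne).symm⟩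
    have hup : ∀ d, AnchoredANOVA.embNorm D ψ p q (AnchoredANOVA.productWeights γ d)
        ≤ ENNReal.ofReal (Real.exp (c * ∑ j ∈ Finset.range d, γ j)) := fun d =>
      (h.idNorm_le_ofReal hψ hρ hp hq hγ hc0 hc d).trans
        (ENNReal.ofReal_le_ofReal (AnchoredANOVA.prod_one_add_le_exp hc0 hγ d))
    have hlow := h.prod_mPsi_div_two_le hD hψ hρ hp hq hγ
    have hm2 : 0 < AnchoredANOVA.mPsi D ψ / 2 := half_pos hm
    refine ⟨fun d _ => ⟨?_, ?_⟩, fun hs => ?_, fun hu => ?_, fun hb => ?_, fun hb hpoly => ?_⟩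
    · exact Subset.antisymm (h.symm.weightedSpace_subset hψ hρ hp hγ)
        (h.weightedSpace_subset hψ hρ hp hγ)
    · exact le_antisymm (h.idNorm_le_symm hψ hρ hp q hγ) (h.symm.idNorm_le_symm hψ hρ hp q hγ)
    · refine lt_of_le_of_lt (iSup₂_le fun d _ => (hup d).trans (ENNReal.ofReal_le_ofReal ?_))
        (ENNReal.ofReal_lt_top (r := Real.exp (c * ∑' j, γ j)))
      exact Real.exp_le_exp.2 (mul_le_mul_of_nonneg_left
        (hs.sum_le_tsum _ fun j _ => (hγ j).le) hc0)
    · have hne : (⨆ (d : ℕ) (_ : 1 ≤ d),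
          AnchoredANOVA.embNorm D ψ p q (AnchoredANOVA.productWeights γ d)) ≠ ∞ := ne_of_lt hu
      refine summable_of_sum_range_le (c := (⨆ (d : ℕ) (_ : 1 ≤ d), AnchoredANOVA.embNorm D ψ p q
        (AnchoredANOVA.productWeights γ d)).toReal / (AnchoredANOVA.mPsi D ψ / 2))
        (fun j => (hγ j).le) fun d => ?_
      -- The supremum runs over `d ≥ 1` only, so the lower bound is applied at `d + 1` to cover `d =
      -- 0`.
      have h1 : ∑ j ∈ Finset.range d, γ j ≤ ∑ j ∈ Finset.range (d + 1), γ j :=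
        Finset.sum_le_sum_of_subset_of_nonneg (Finset.range_mono d.le_succ) fun j _ _ => (hγ j).le
      have h2 := (hlow (d + 1)).trans
        (le_iSup₂ (f := fun (d : ℕ) (_ : 1 ≤ d) =>
          AnchoredANOVA.embNorm D ψ p q (AnchoredANOVA.productWeights γ d)) (d + 1) (by omega))
      have h3 := (ENNReal.ofReal_le_iff_le_toReal hne).1 h2
      have h4 := AnchoredANOVA.sum_le_prod_one_add hm2 hγ (d + 1)
      rw [le_div_iff₀ hm2]
      have h5 := mul_le_mul_of_nonneg_left h1 hm2.le
      linarith
    · obtain ⟨B, hB⟩ := hb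
      have hτ : 0 < c * max B 0 + 1 := by positivity
      refine ⟨c * max B 0 + 1, hτ, 2 ^ (c * max B 0 + 1), ?_⟩
      filter_upwards [Filter.eventually_ge_atTop 1] with d hd
      refine (hup d).trans (ENNReal.ofReal_le_ofReal
        (AnchoredANOVA.exp_le_mul_rpow hc0 (le_max_right _ _) hd ?_))
      have hlog : 0 < Real.log (d + 1) := by
        have : (1 : ℝ) ≤ d := by exact_mod_cast hd
        exact Real.log_pos (by linarith)
      exact (div_le_iff₀ hlog).1 ((hB ⟨d, hd, rfl⟩).trans (le_max_left _ _))
    · obtain ⟨M, hM⟩ := hb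
      obtain ⟨τ, hτ, C, hC⟩ := hpoly
      refine AnchoredANOVA.bddAbove_sum_div_log hm2 hγ (fun j => hM ⟨j, rfl⟩) hτ (C := C) ?_
      filter_upwards [hC] with d hd
      have h1 := (hlow d).trans hd
      have hpos : 0 < ∏ j ∈ Finset.range d, (1 + AnchoredANOVA.mPsi D ψ / 2 * γ j) :=
        Finset.prod_pos fun j _ => by have := mul_pos hm2 (hγ j); linarith
      -- `ENNReal.ofReal` truncates negative numbers, and `C` has no known sign; positivity of the
      -- product allows the return to a real inequality.
      by_contra hlt
      rw [not_le] at hlt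
      exact absurd h1 (not_le.2 ((ENNReal.ofReal_lt_ofReal_iff hpos).2 hlt))
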